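/- Let $\mathcal X$ be a Polish space, $\alpha>0$, and let $\Xi$ be a probability distribution on $(0,\infty)\times\mathcal X$ whose first marginal has finite mean. Let $(d_n)_{n\ge 1}$ be i.i.d. $\mathrm{Exp}(\alpha)$ random variables and let $((a_n,\chi_n))_{n\ge 1}$ be i.i.d. with law $\Xi$, independent of $(d_n)_n$. Put $T_n=d_n+a_n$ and $S_n=T_1+\dots+T_n$ (with $S_0=0$), and consider the point process $\eta=\sum_{n\ge 1}\delta_{(S_{n-1}+d_n,\,S_n,\,\chi_n)}$. The system $\eta$ is called dormant at time $t\ge 0$ if $t\in[S_{n-1},S_{n-1}+d_n)$ for some $n\ge 1$. Let $E:\mathcal X\to\mathbb R\cup\{-\infty\}$ be measurable, and for a finite configuration $\zeta=\sum_{k=1}^m\delta_{(s_k,u_k,x_k)}$ let $\mathcal H(\zeta)=\sum_{k=1}^m E(x_k)$ (with $e^{\infty}=\infty=\log\infty$). For $t>0$ let $\Gamma_{t}$ be the law, conditionally on $\{\eta\text{ is dormant at }2t\}$, of the configuration obtained from $\eta$ by translating it by $-t$ in time and keeping only the marked intervals $(s,u,x)$ with $[s,u]\cap[-t,t]\neq\emptyset$,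 and define $$\mathbf Z_{2t}=\int e^{-\mathcal H(\zeta)}\,\Gamma_{t}(\mathrm d\zeta)\in(0,\infty].$$ Let $(\mathrm G')$ denote the condition that there exists $\lambda\in\mathbb R$ with $\mathbb E\big[e^{-\lambda T_1-E(\chi_1)}\big]=1$ and $\mathbb E\big[T_1e^{-\lambda T_1-E(\chi_1)}\big]<\infty$. Then the limit $\varphi=\lim_{t\to\infty}\frac1t\log\mathbf Z_t$ (the free energy) exists in $\mathbb R\cup\{\infty\}$. If $\varphi<\infty$, then, irrespective of whether $(\mathrm G')$ holds, $$\varphi=\min\Big\{\lambda\in\mathbb R:\ \mathbb E\big[e^{-\lambda T_1-E(\chi_1)}\big]\le 1\Big\},$$ and if in addition $(\mathrm G')$ does not hold, then $\lim_{t\to\infty}\mathbf Z_te^{-\varphi t}=0$. -/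

import Mathlib

open MeasureTheory ProbabilityTheory Filter Topology
open scoped ENNReal

noncomputable section

namespace AlternatingProcess

/-- `(d n)` is an i.i.d. sequence of `Exp(α)` random variables and `(a n, χ n)` is an i.i.d. sequence
of random variables with law `Ξ`, independent of `(d n)`. The sequences are indexed from `0`, so
`d n`, `a n`, `χ n` are the dormant period, active period and state number `n + 1`. -/
structure IsAlternatingSequence {Ω X : Type*} [MeasurableSpace Ω] [MeasurableSpace X]
    (P : Measure Ω) (α : ℝ) (Ξ : Measure (ℝ × X))
    (d a : ℕ → Ω → ℝ) (χ : ℕ → Ω → X) : Prop where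
  measurable_d : ∀ n, Measurable (d n)
  measurable_a : ∀ n, Measurable (a n)
  measurable_χ : ∀ n, Measurable (χ n)
  law_d : ∀ n, P.map (d n) = expMeasure α
  law_aχ : ∀ n, P.map (fun ω => (a n ω, χ n ω)) = Ξ
  indep_d : iIndepFun d P
  indep_aχ : iIndepFun (fun n ω => (a n ω, χ n ω)) P
  indep_d_aχ : IndepFun (fun ω n => d n ω) (fun ω n => (a n ω, χ n ω)) P

variable {Ω X : Type*} [MeasurableSpace Ω] [MeasurableSpace X]

/-- The embedded renewal process `S_n = ∑_{k < n} (d_k + a_k)`: the time at which dormant period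
number `n + 1` starts. -/
def renewalTime (d a : ℕ → Ω → ℝ) (n : ℕ) (ω : Ω) : ℝ :=
  ∑ k ∈ Finset.range n, (d k ω + a k ω)

/-- The time at which active period number `n + 1` starts; it ends at `renewalTime d a (n + 1)`. -/
def activeStart (d a : ℕ → Ω → ℝ) (n : ℕ) (ω : Ω) : ℝ :=
  renewalTime d a n ω + d n ω

/-- The event that the system is dormant at time `t`. -/
def dormantAt (d a : ℕ → Ω → ℝ) (t : ℝ) : Set Ω :=
  {ω | ∃ n, renewalTime d a n ω ≤ t ∧ t < activeStart d a n ω}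

/-- The point process `η` of marked active intervals, as a random counting measure. A point
`(s, u, x)` stands for the active interval `[s, u)` with state `x`. -/
def eta (d a : ℕ → Ω → ℝ) (χ : ℕ → Ω → X) (ω : Ω) : Measure (ℝ × ℝ × X) :=
  Measure.sum fun n =>
    Measure.dirac (activeStart d a n ω, renewalTime d a (n + 1) ω, χ n ω)

/-- The set of all marked intervals that intersect `[b, c]`. -/
def meeting (X : Type*) (b c : ℝ) : Set (ℝ × ℝ × X) :=
  {p | p.1 < p.2.1 ∧ (Set.Icc p.1 p.2.1 ∩ Set.Icc b c).Nonempty}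

/-- Restriction of a configuration to all marked intervals that intersect `[b, c]`. -/
def restrictTo (b c : ℝ) (ζ : Measure (ℝ × ℝ × X)) : Measure (ℝ × ℝ × X) :=
  ζ.restrict (meeting X b c)

/-- Translation of a configuration by `-t`. -/
def translate (t : ℝ) (ζ : Measure (ℝ × ℝ × X)) : Measure (ℝ × ℝ × X) :=
  ζ.map fun p => (p.1 - t, p.2.1 - t, p.2.2)

/-- The Hamiltonian `H(ζ) = ∑_k E(x_k)` of a finite configuration `ζ = ∑_k δ_(s_k, u_k, x_k)`:
the integral of `E` against the counting measure `ζ`, as positive part minus negative part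
(`E < ∞`, so the positive part is finite for finite `ζ`). -/
def hamiltonian (E : X → EReal) (ζ : Measure (ℝ × ℝ × X)) : EReal :=
  ((∫⁻ p, (E p.2.2).toENNReal ∂ζ : ℝ≥0∞) : EReal)
    - ((∫⁻ p, (-E p.2.2).toENNReal ∂ζ : ℝ≥0∞) : EReal)

/-- The reference measure on `[-t, t]` with dormant boundary conditions: the law of the
restriction to `[-t, t]` of `η` translated by `-t`, conditionally on `η` being dormant at `2t`. -/
def referenceLaw (P : Measure Ω) (d a : ℕ → Ω → ℝ) (χ : ℕ → Ω → X) (t : ℝ) :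
    Measure (Measure (ℝ × ℝ × X)) :=
  (cond P (dormantAt d a (2 * t))).map fun ω => restrictTo (-t) t (translate t (eta d a χ ω))

/-- The partition function `Z_t`, where `Z_{2t}` is the integral of `exp(-H)` against the
reference measure on `[-t, t]`; it takes values in `[0, ∞]`. -/
def partitionFunction (P : Measure Ω) (d a : ℕ → Ω → ℝ) (χ : ℕ → Ω → X) (E : X → EReal)
    (t : ℝ) : ℝ≥0∞ :=
  ∫⁻ ζ, EReal.exp (-hamiltonian E ζ) ∂(referenceLaw P d a χ (t / 2))

/-- The free energy `φ = lim_{t → ∞} log(Z_t) / t`. -/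
def freeEnergy (P : Measure Ω) (d a : ℕ → Ω → ℝ) (χ : ℕ → Ω → X) (E : X → EReal) : EReal :=
  limUnder (atTop : Filter ℝ) fun t =>
    ENNReal.log (partitionFunction P d a χ E t) / (t : EReal)

/-- The first interarrival time `T_1 = d_1 + a_1`. -/
def firstCycle (d a : ℕ → Ω → ℝ) (ω : Ω) : ℝ := d 0 ω + a 0 ω

/-- The weight `exp(-λ T_1 - E(χ_1))`, with values in `(0, ∞]`. -/
def tiltWeight (d a : ℕ → Ω → ℝ) (χ : ℕ → Ω → X) (E : X → EReal) (lam : ℝ) (ω : Ω) : ℝ≥0∞ :=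
  EReal.exp (((-lam * firstCycle d a ω : ℝ) : EReal) - E (χ 0 ω))

/-- The condition `(G')`: there is a real `λ` with `𝔼[exp(-λ T_1 - E(χ_1))] = 1` and
`𝔼[T_1 exp(-λ T_1 - E(χ_1))] < ∞`. -/
def Goodness (P : Measure Ω) (d a : ℕ → Ω → ℝ) (χ : ℕ → Ω → X) (E : X → EReal) : Prop :=
  ∃ lam : ℝ, ∫⁻ ω, tiltWeight d a χ E lam ω ∂P = 1 ∧
    ∫⁻ ω, ENNReal.ofReal (firstCycle d a ω) * tiltWeight d a χ E lam ω ∂P < ∞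

end AlternatingProcess

end

noncomputable section

namespace AlternatingProcess

/-! Weighting every completed cycle by `exp(-E)` turns the law of an active period into a measure
`ρ₀` on `(0, ∞)`, possibly of infinite mass. The weighted expectation over the event of dormancy at
`t` is then the renewal series `g(t) = dormantMass α ρ₀ t`, and conditioning divides it by
`dormantMass α ρ₁ t`, with `ρ₁` the unweighted law (`partitionFunction_eq`). As `ρ₁` is a
probability measure of finite mean, the denominator lies between a positive constant and `1`, so
only the growth of `g` matters.

Memorylessness of dormant periods makes `g` supermultiplicative (`dormantMass_mul_le`), and Fekete's
lemma yields `φ = sup log g(t) / t`. Multiplying `g` by `exp(-λt)` produces the dormant mass for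
`Exp(α + λ)` periods and a tilted measure whose total mass is `𝔼[exp(-λT₁ - E(χ₁))]`
(`exp_mul_dormantMass`, `lintegral_tiltWeight`). If that mass is at most `1`, the tilted dormant
mass is at most `1` and `φ ≤ λ`. If `λ > φ`, then `exp(-λt) g(t)` is integrable, while its integral
is a geometric series in the tilted mass, so this mass is below `1`; Fatou's lemma as `λ ↓ φ` puts
`φ` itself into the set.

If `(G')` fails, the measure tilted by `φ` has mass below `1`, or mass `1` and infinite mean.
Reading missing mass as infinite active periods, its tail has infinite integral in both cases.
Dormant mass `h` and tail satisfy the balance `h + β (tail ⋆ h) = 1`. Were `c = limsup h` positive,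
take times `T k` along which `h` approaches `c`; the renewal equation forces `h(T k - y)` to
approach `c` for each fixed `y ≥ 0`, and Fatou's lemma in the balance gives `β c ∫ tail ≤ 1`, a
contradiction (`tendsto_dormantMass_zero`). -/

/-- The probability that an `Exp(β)` dormant period started at time `0` still lasts at time `t`. -/
def survival (β t : ℝ) : ℝ≥0∞ := (Set.Ici 0).indicator (fun t => ENNReal.ofReal (Real.exp (-(β * t)))) t

/-- The average of the translates `v (· - a)` with respect to `ρ`. -/
def shiftAverage (ρ : Measure ℝ) (v : ℝ → ℝ≥0∞) (t : ℝ) : ℝ≥0∞ := ∫⁻ a, v (t - a) ∂ρ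

/-- Prepending one cycle: an `Exp(β)` dormant period followed by an active period with
distribution `ρ`. -/
def cycleStep (β : ℝ) (ρ : Measure ℝ) (v : ℝ → ℝ≥0∞) : ℝ → ℝ≥0∞ :=
  exponentialPDF β ⋆ₗ shiftAverage ρ v

/-- The contribution to `dormantMass` of the trajectories with exactly `n` completed cycles. -/
def dormantTerm (β : ℝ) (ρ : Measure ℝ) (n : ℕ) : ℝ → ℝ≥0∞ := (cycleStep β ρ)^[n] (survival β)

/-- The total mass at time `t` of dormant trajectories, for dormant periods with law `Exp(β)` and
active periods distributed according to the (not necessarily finite) measure `ρ`. -/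
def dormantMass (β : ℝ) (ρ : Measure ℝ) (t : ℝ) : ℝ≥0∞ := ∑' n, dormantTerm β ρ n t

/-! ### Renewal equation, supermultiplicativity and exponential tilting. -/

section Basic

variable {β : ℝ} {ρ : Measure ℝ}

lemma measurable_exponentialPDF (β : ℝ) : Measurable (exponentialPDF β) :=
  (measurable_exponentialPDFReal β).ennreal_ofReal

@[fun_prop]
lemma measurable_survival (β : ℝ) : Measurable (survival β) := by
  unfold survival
  exact Measurable.indicator (by fun_prop) measurableSet_Ici

lemma survival_of_nonneg {t : ℝ} (ht : 0 ≤ t) :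
    survival β t = ENNReal.ofReal (Real.exp (-(β * t))) := by
  simp [survival, ht]

lemma survival_of_neg {t : ℝ} (ht : t < 0) : survival β t = 0 := by
  simp [survival, ht]

lemma survival_ne_top (t : ℝ) : survival β t ≠ ∞ := by
  rcases lt_or_ge t 0 with h | h
  · simp [survival_of_neg h]
  · simp [survival_of_nonneg h]

lemma survival_add {s t : ℝ} (hs : 0 ≤ s) (ht : 0 ≤ t) :
    survival β (s + t) = survival β s * survival β t := by
  rw [survival_of_nonneg hs, survival_of_nonneg ht, survival_of_nonneg (add_nonneg hs ht),
    ← ENNReal.ofReal_mul (Real.exp_pos _).le, ← Real.exp_add]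
  ring_nf

lemma exponentialPDF_eq_mul_survival (hβ : 0 < β) (t : ℝ) :
    exponentialPDF β t = ENNReal.ofReal β * survival β t := by
  rcases lt_or_ge t 0 with h | h
  · simp [survival_of_neg h, exponentialPDF_of_neg h]
  · rw [survival_of_nonneg h, exponentialPDF_of_nonneg h, ENNReal.ofReal_mul hβ.le]

lemma exponentialPDF_add (hβ : 0 < β) {s t : ℝ} (hs : 0 ≤ s) (ht : 0 ≤ t) :
    exponentialPDF β (s + t) = survival β s * exponentialPDF β t := by
  rw [exponentialPDF_eq_mul_survival hβ, exponentialPDF_eq_mul_survival hβ, survival_add hs ht]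
  ring

lemma survival_add_lintegral_exponentialPDF (hβ : 0 < β) {t : ℝ} (ht : 0 ≤ t) :
    survival β t + ∫⁻ y in Set.Iic t, exponentialPDF β y = 1 := by
  rw [lintegral_exponentialPDF_eq_antiDeriv hβ, if_pos ht, survival_of_nonneg ht,
    ← ENNReal.ofReal_add (Real.exp_pos _).le]
  · simp
  · have : Real.exp (-(β * t)) ≤ 1 := Real.exp_le_one_iff.2 (by nlinarith)
    linarith

@[fun_prop]
lemma measurable_shiftAverage [SFinite ρ] {v : ℝ → ℝ≥0∞} (hv : Measurable v) :
    Measurable (shiftAverage ρ v) := by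
  unfold shiftAverage
  fun_prop

@[fun_prop]
lemma measurable_cycleStep [SFinite ρ] {v : ℝ → ℝ≥0∞} (hv : Measurable v) :
    Measurable (cycleStep β ρ v) :=
  measurable_lconvolution _ (measurable_exponentialPDF β) (measurable_shiftAverage hv)

lemma dormantTerm_succ (n : ℕ) : dormantTerm β ρ (n + 1) = cycleStep β ρ (dormantTerm β ρ n) := by
  simp only [dormantTerm, Function.iterate_succ', Function.comp]

@[fun_prop]
lemma measurable_dormantTerm [SFinite ρ] (n : ℕ) : Measurable (dormantTerm β ρ n) := by
  induction n with
  | zero => exact measurable_survival β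
  | succ n ih => rw [dormantTerm_succ]; exact measurable_cycleStep ih

@[fun_prop]
lemma measurable_dormantMass [SFinite ρ] : Measurable (dormantMass β ρ) := by
  unfold dormantMass
  fun_prop

lemma shiftAverage_tsum {v : ℕ → ℝ → ℝ≥0∞} (hv : ∀ n, Measurable (v n)) :
    shiftAverage ρ (fun t => ∑' n, v n t) = fun t => ∑' n, shiftAverage ρ (v n) t := by
  ext t
  unfold shiftAverage
  exact lintegral_tsum fun n => by have := hv n; fun_prop

lemma cycleStep_tsum [SFinite ρ] {v : ℕ → ℝ → ℝ≥0∞} (hv : ∀ n, Measurable (v n)) (t : ℝ) :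
    cycleStep β ρ (fun t => ∑' n, v n t) t = ∑' n, cycleStep β ρ (v n) t := by
  simp only [cycleStep, lconvolution_def, shiftAverage_tsum hv, ← ENNReal.tsum_mul_left]
  refine lintegral_tsum fun n => ?_
  have := measurable_shiftAverage (ρ := ρ) (hv n)
  have := measurable_exponentialPDF β
  fun_prop

/-- The renewal equation. -/
lemma dormantMass_eq [SFinite ρ] (t : ℝ) :
    dormantMass β ρ t = survival β t + cycleStep β ρ (dormantMass β ρ) t := by
  conv_lhs => rw [dormantMass, tsum_eq_zero_add' ENNReal.summable]
  congr 1
  simp only [dormantTerm_succ]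
  exact (cycleStep_tsum (fun n => measurable_dormantTerm n) t).symm

lemma cycleStep_mono {u v : ℝ → ℝ≥0∞} (h : u ≤ v) : cycleStep β ρ u ≤ cycleStep β ρ v := by
  intro t
  simp only [cycleStep, lconvolution_def, shiftAverage]
  gcongr
  apply h

/-- The mass of the trajectories with fewer than `N` completed cycles. -/
lemma sum_dormantTerm_succ [SFinite ρ] (N : ℕ) (t : ℝ) :
    ∑ n ∈ Finset.range (N + 1), dormantTerm β ρ n t =
      survival β t + cycleStep β ρ (fun s => ∑ n ∈ Finset.range N, dormantTerm β ρ n s) t := by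
  rw [Finset.sum_range_succ', add_comm]
  congr 1
  -- The finite sum is treated as a series with zero tail, so that linearity of `cycleStep` over
  -- series applies.
  have h := cycleStep_tsum (β := β) (ρ := ρ)
    (v := fun n => if n ∈ Finset.range N then dormantTerm β ρ n else 0)
    (fun n => by split_ifs <;> first | exact measurable_dormantTerm n | exact measurable_zero) t
  have hs : ∀ s, ∑' n, (if n ∈ Finset.range N then dormantTerm β ρ n else 0) s =
      ∑ n ∈ Finset.range N, dormantTerm β ρ n s := fun s => by
    rw [tsum_eq_sum (s := Finset.range N)]
    · exact Finset.sum_congr rfl fun n hn => by rw [if_pos hn]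
    · intro n hn; rw [if_neg hn]; rfl
  simp only [hs] at h
  rw [h, tsum_eq_sum (s := Finset.range N)]
  · exact Finset.sum_congr rfl fun n hn => by rw [if_pos hn, dormantTerm_succ]
  · intro n hn
    rw [if_neg hn]
    simp [cycleStep, lconvolution_def, shiftAverage]

lemma dormantMass_le_of_forall_sum_le {t : ℝ} {c : ℝ≥0∞}
    (h : ∀ N, ∑ n ∈ Finset.range N, dormantTerm β ρ n t ≤ c) : dormantMass β ρ t ≤ c := by
  rw [dormantMass, ENNReal.tsum_eq_iSup_nat]
  exact iSup_le h

lemma survival_le_dormantMass [SFinite ρ] (t : ℝ) : survival β t ≤ dormantMass β ρ t := by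
  rw [dormantMass_eq]; exact le_self_add

lemma shiftAverage_of_nonpos (hρ : ∀ᵐ a ∂ρ, 0 < a) {v : ℝ → ℝ≥0∞} (hv : ∀ t < 0, v t = 0)
    {t : ℝ} (ht : t ≤ 0) : shiftAverage ρ v t = 0 := by
  refine (lintegral_congr_ae ?_).trans lintegral_zero
  filter_upwards [hρ] with a ha
  exact hv _ (by linarith)

lemma cycleStep_of_neg (hρ : ∀ᵐ a ∂ρ, 0 < a) {v : ℝ → ℝ≥0∞} (hv : ∀ t < 0, v t = 0)
    {t : ℝ} (ht : t < 0) : cycleStep β ρ v t = 0 := by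
  refine (lintegral_congr fun y => ?_).trans lintegral_zero
  rcases lt_or_ge y 0 with h | h
  · simp [exponentialPDF_of_neg h]
  · simp [shiftAverage_of_nonpos hρ hv (t := -y + t) (by linarith)]

lemma dormantTerm_of_neg (hρ : ∀ᵐ a ∂ρ, 0 < a) (n : ℕ) {t : ℝ} (ht : t < 0) :
    dormantTerm β ρ n t = 0 := by
  induction n generalizing t with
  | zero => exact survival_of_neg ht
  | succ n ih => rw [dormantTerm_succ]; exact cycleStep_of_neg hρ (fun t ht => ih ht) ht

lemma dormantMass_of_neg (hρ : ∀ᵐ a ∂ρ, 0 < a) {t : ℝ} (ht : t < 0) : dormantMass β ρ t = 0 := by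
  simp [dormantMass, dormantTerm_of_neg hρ _ ht]

/-- Conditioning on the first dormant period, at time `s`. -/
lemma dormantMass_add (hβ : 0 < β) [SFinite ρ] {s t : ℝ} (hs : 0 ≤ s) (ht : 0 ≤ t) :
    dormantMass β ρ (s + t) = survival β s * dormantMass β ρ t +
      ∫⁻ y in Set.Iio s, exponentialPDF β y * shiftAverage ρ (dormantMass β ρ) (-y + (s + t)) := by
  -- A first dormant period that outlives `s` starts afresh at `s`: shift the integration variable
  -- by `s` and use `exponentialPDF_add`.
  have h1 : survival β s * cycleStep β ρ (dormantMass β ρ) t = ∫⁻ y in (Set.Iio s)ᶜ,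
      exponentialPDF β y * shiftAverage ρ (dormantMass β ρ) (-y + (s + t)) := by
    rw [cycleStep, lconvolution_def, ← lintegral_const_mul' _ _ (survival_ne_top s),
      ← lintegral_indicator measurableSet_Iio.compl]
    refine Eq.trans ?_ (lintegral_add_left_eq_self _ s)
    refine lintegral_congr fun y => ?_
    rw [Set.indicator_apply]
    rcases lt_or_ge y 0 with h | h
    · simp [exponentialPDF_of_neg h, h]
    · rw [if_pos (by simpa using h), exponentialPDF_add hβ hs h, mul_assoc]
      ring_nf
  have h2 := dormantMass_eq (β := β) (ρ := ρ) (s + t)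
  rw [cycleStep, lconvolution_def, ← lintegral_add_compl _ (measurableSet_Iio (a := s)), ← h1] at h2
  rw [h2, survival_add hs ht, dormantMass_eq t]
  ring

/-- A trajectory dormant at `s` can be continued, by memorylessness, by a fresh one run for time
`t`; the result is dormant at `s + t`. The product only counts trajectories that are also dormant at
`s`, hence an inequality. -/
lemma dormantMass_mul_le (hβ : 0 < β) [SFinite ρ] (hρ : ∀ᵐ a ∂ρ, 0 < a) {s t : ℝ}
    (hs : 0 ≤ s) (ht : 0 ≤ t) :
    dormantMass β ρ s * dormantMass β ρ t ≤ dormantMass β ρ (s + t) := by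
  -- The induction bounds the number of cycles completed before `s`. It is uniform in `s`, because
  -- peeling off the first cycle shortens `s`.
  have key : ∀ N s, 0 ≤ s → (∑ n ∈ Finset.range N, dormantTerm β ρ n s) * dormantMass β ρ t
      ≤ dormantMass β ρ (s + t) := by
    intro N
    induction N with
    | zero => simp
    | succ N ih =>
      intro s hs
      set u : ℝ → ℝ≥0∞ := fun s => ∑ n ∈ Finset.range N, dormantTerm β ρ n s with hu
      have hum : Measurable u := by fun_prop
      have hun : ∀ r < 0, u r = 0 := fun r hr => by
        simp [hu, dormantTerm_of_neg hρ _ hr]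
      have hum' := measurable_shiftAverage (ρ := ρ) hum
      have hm := measurable_exponentialPDF β
      rw [sum_dormantTerm_succ, ← hu, add_mul, dormantMass_add hβ hs ht]
      gcongr
      rw [cycleStep, lconvolution_def, ← lintegral_mul_const _ (by fun_prop),
        ← lintegral_indicator measurableSet_Iio]
      refine lintegral_mono fun y => ?_
      rw [Set.indicator_apply]
      split_ifs with hy
      · rw [mul_assoc]
        gcongr
        rw [shiftAverage, shiftAverage, ← lintegral_mul_const _ (by fun_prop)]
        refine lintegral_mono fun a => ?_
        rcases lt_or_ge (-y + s - a) 0 with h | h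
        · rw [hun _ h, zero_mul]; exact zero_le
        · convert ih _ h using 2
          ring
      -- The boundary `y = s` is covered too, since active periods are strictly positive.
      · rw [shiftAverage_of_nonpos hρ hun (t := -y + s) (by simpa using hy)]; simp
  rw [dormantMass, ENNReal.tsum_eq_iSup_nat, ENNReal.iSup_mul]
  exact iSup_le fun N => key N s hs

lemma survival_mul_dormantMass_le (hβ : 0 < β) [SFinite ρ] (hρ : ∀ᵐ a ∂ρ, 0 < a) {s t : ℝ}
    (hs : 0 ≤ s) (ht : 0 ≤ t) :
    survival β s * dormantMass β ρ t ≤ dormantMass β ρ (s + t) :=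
  (mul_le_mul_left (survival_le_dormantMass s) _).trans (dormantMass_mul_le hβ hρ hs ht)

lemma lintegral_survival (hβ : 0 < β) : ∫⁻ t, survival β t = (ENNReal.ofReal β)⁻¹ := by
  have h := lintegral_exponentialPDF_eq_one hβ
  simp only [exponentialPDF_eq_mul_survival hβ] at h
  rw [lintegral_const_mul _ (measurable_survival β)] at h
  exact ENNReal.eq_inv_of_mul_eq_one_left (by rw [mul_comm]; exact h)

/-- The total mass of the trajectories on the time axis. -/
lemma lintegral_dormantMass (hβ : 0 < β) [SFinite ρ] :
    ∫⁻ t, dormantMass β ρ t = (ENNReal.ofReal β)⁻¹ * (1 - ρ Set.univ)⁻¹ := by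
  have hb : ENNReal.ofReal β ≠ 0 := by simpa using hβ
  have hm := measurable_exponentialPDF β
  -- Each cycle multiplies the integral by the mass of the exponential density, which is `1`, and by
  -- that of `ρ`.
  have hterm : ∀ n, ∫⁻ t, dormantTerm β ρ n t = (ENNReal.ofReal β)⁻¹ * (ρ Set.univ) ^ n := by
    intro n
    induction n with
    | zero => rw [pow_zero, mul_one]; exact lintegral_survival hβ
    | succ n ih =>
      have hs := measurable_shiftAverage (ρ := ρ) (measurable_dormantTerm (β := β) (ρ := ρ) n)
      have hR : ∫⁻ t, shiftAverage ρ (dormantTerm β ρ n) t =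
          (ENNReal.ofReal β)⁻¹ * (ρ Set.univ) ^ n * ρ Set.univ := by
        simp only [shiftAverage]
        rw [lintegral_lintegral_swap (by fun_prop)]
        simp only [lintegral_sub_right_eq_self (fun t => dormantTerm β ρ n t), ih]
        simp
      rw [dormantTerm_succ]
      simp only [cycleStep, lconvolution_def]
      rw [lintegral_lintegral_swap (by fun_prop)]
      have : ∀ y, ∫⁻ t, exponentialPDF β y * shiftAverage ρ (dormantTerm β ρ n) (-y + t) =
          exponentialPDF β y * ((ENNReal.ofReal β)⁻¹ * (ρ Set.univ) ^ n * ρ Set.univ) := fun y => by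
        rw [lintegral_const_mul _ (by fun_prop), lintegral_add_left_eq_self, hR]
      simp only [this]
      rw [lintegral_mul_const _ hm, lintegral_exponentialPDF_eq_one hβ, one_mul, pow_succ, mul_assoc]
  simp only [dormantMass]
  rw [lintegral_tsum fun n => by fun_prop]
  simp only [hterm]
  rw [ENNReal.tsum_mul_left, ENNReal.tsum_geometric]

/-- Exponential tilting. -/
lemma exp_mul_dormantMass (hβ : 0 < β) [SFinite ρ] {lam : ℝ} (hl : 0 < β + lam) (t : ℝ) :
    ENNReal.ofReal (Real.exp (-(lam * t))) * dormantMass β ρ t = dormantMass (β + lam)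
      (ρ.withDensity fun a => ENNReal.ofReal (β / (β + lam) * Real.exp (-(lam * a)))) t := by
  set ρ' := ρ.withDensity fun a => ENNReal.ofReal (β / (β + lam) * Real.exp (-(lam * a))) with hρ'
  have key : ∀ n t, ENNReal.ofReal (Real.exp (-(lam * t))) * dormantTerm β ρ n t =
      dormantTerm (β + lam) ρ' n t := by
    intro n
    induction n with
    | zero =>
      intro t
      rcases lt_or_ge t 0 with h | h
      · simp [dormantTerm, survival_of_neg h]
      · simp only [dormantTerm, Function.iterate_zero, id, survival_of_nonneg h]
        rw [← ENNReal.ofReal_mul (Real.exp_pos _).le, ← Real.exp_add]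
        ring_nf
    | succ n ih =>
      intro t
      have hs := measurable_shiftAverage (ρ := ρ) (measurable_dormantTerm (β := β) (ρ := ρ) n)
      rw [dormantTerm_succ, dormantTerm_succ, cycleStep, cycleStep, lconvolution_def,
        lconvolution_def, ← lintegral_const_mul' _ _ ENNReal.ofReal_ne_top]
      refine lintegral_congr fun y => ?_
      rcases lt_or_ge y 0 with h | h
      · simp [exponentialPDF_of_neg h]
      · have hR : shiftAverage ρ' (dormantTerm (β + lam) ρ' n) (-y + t) =
            ENNReal.ofReal (β / (β + lam) * Real.exp (-(lam * (-y + t)))) *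
              shiftAverage ρ (dormantTerm β ρ n) (-y + t) := by
          rw [shiftAverage, shiftAverage, hρ', lintegral_withDensity_eq_lintegral_mul _
            (by fun_prop) (by rw [← hρ']; fun_prop), ← hρ', ← lintegral_const_mul' _ _ ENNReal.ofReal_ne_top]
          refine lintegral_congr fun a => ?_
          rw [Pi.mul_apply, ← ih, ← mul_assoc, ← ENNReal.ofReal_mul (by positivity), mul_assoc,
            ← Real.exp_add]
          ring_nf
        rw [hR, exponentialPDF_of_nonneg h, exponentialPDF_of_nonneg h, ← mul_assoc, ← mul_assoc,
          ← ENNReal.ofReal_mul (Real.exp_pos _).le, ← ENNReal.ofReal_mul (by positivity)]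
        congr 2
        have e : Real.exp (-(lam * t)) * Real.exp (-(β * y)) =
            Real.exp (-((β + lam) * y)) * Real.exp (-(lam * (-y + t))) := by
          rw [← Real.exp_add, ← Real.exp_add]; ring_nf
        calc _ = β * (Real.exp (-(lam * t)) * Real.exp (-(β * y))) := by ring
          _ = _ := by rw [e]; field_simp
  simp only [dormantMass, ← key, ENNReal.tsum_mul_left]

end Basic

/-! ### Active periods of total mass at most one: balance equation and long-time behaviour. -/

section SubProbability

variable {β : ℝ} {ρ : Measure ℝ}

/-- The indicator function of `[0, ∞)`. -/
def unitStep : ℝ → ℝ≥0∞ := (Set.Ici 0).indicator 1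

@[fun_prop]
lemma measurable_unitStep : Measurable unitStep := measurable_one.indicator measurableSet_Ici

lemma unitStep_of_nonneg {t : ℝ} (ht : 0 ≤ t) : unitStep t = 1 := by simp [unitStep, ht]

lemma unitStep_of_neg {t : ℝ} (ht : t < 0) : unitStep t = 0 := by simp [unitStep, ht]

lemma unitStep_le_one (t : ℝ) : unitStep t ≤ 1 := by
  rcases lt_or_ge t 0 with h | h
  · simp [unitStep_of_neg h]
  · simp [unitStep_of_nonneg h]

lemma add_lconvolution (u v w : ℝ → ℝ≥0∞) (hu : Measurable u) (hw : Measurable w) (t : ℝ) :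
    ((u + v) ⋆ₗ w) t = (u ⋆ₗ w) t + (v ⋆ₗ w) t := by
  simp only [lconvolution_def, Pi.add_apply, add_mul]
  exact lintegral_add_left (by fun_prop) _

lemma lconvolution_add (u v w : ℝ → ℝ≥0∞) (hu : Measurable u) (hv : Measurable v) (t : ℝ) :
    (u ⋆ₗ (v + w)) t = (u ⋆ₗ v) t + (u ⋆ₗ w) t := by
  simp only [lconvolution_def, Pi.add_apply, mul_add]
  exact lintegral_add_left (by fun_prop) _

lemma survival_add_lconvolution (hβ : 0 < β) :
    survival β + exponentialPDF β ⋆ₗ unitStep = unitStep := by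
  ext t
  rcases lt_or_ge t 0 with h | h
  · rw [Pi.add_apply, unitStep_of_neg h, survival_of_neg h, zero_add, lconvolution_def]
    refine (lintegral_congr fun y => ?_).trans lintegral_zero
    rcases lt_or_ge y 0 with h' | h'
    · simp [exponentialPDF_of_neg h']
    · simp [unitStep_of_neg (t := -y + t) (by linarith)]
  · rw [Pi.add_apply, unitStep_of_nonneg h, ← survival_add_lintegral_exponentialPDF hβ h,
      lconvolution_def, ← lintegral_indicator measurableSet_Iic]
    congr 1
    refine lintegral_congr fun y => ?_
    rw [Set.indicator_apply]
    split_ifs with hy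
    · rw [unitStep_of_nonneg (by simpa using hy), mul_one]
    · rw [unitStep_of_neg (by simpa using hy), mul_zero]

lemma shiftAverage_unitStep_le (hρ : ∀ᵐ a ∂ρ, 0 < a) (hm : ρ Set.univ ≤ 1) :
    shiftAverage ρ unitStep ≤ unitStep := by
  intro t
  rcases lt_or_ge t 0 with h | h
  · rw [shiftAverage_of_nonpos hρ (fun t ht => unitStep_of_neg ht) h.le]
    exact zero_le
  · rw [unitStep_of_nonneg h]
    calc shiftAverage ρ unitStep t ≤ ∫⁻ _, 1 ∂ρ := lintegral_mono fun _ => unitStep_le_one _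
      _ ≤ 1 := by simpa using hm

/-- `unitStep` is a supersolution of the renewal equation, so it dominates every partial sum of the
series. -/
lemma dormantMass_le_one (hβ : 0 < β) [SFinite ρ] (hρ : ∀ᵐ a ∂ρ, 0 < a) (hm : ρ Set.univ ≤ 1)
    (t : ℝ) : dormantMass β ρ t ≤ 1 := by
  refine dormantMass_le_of_forall_sum_le fun N => (le_trans ?_ (unitStep_le_one t))
  induction N generalizing t with
  | zero => simp
  | succ N ih =>
    rw [sum_dormantTerm_succ]
    calc _ ≤ survival β t + cycleStep β ρ unitStep t := by
          gcongr
          exact cycleStep_mono ih t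
      _ ≤ survival β t + (exponentialPDF β ⋆ₗ unitStep) t := by
          gcongr
          refine lintegral_mono fun y => ?_
          gcongr
          exact shiftAverage_unitStep_le hρ hm _
      _ = unitStep t := congrFun (survival_add_lconvolution hβ) t

/-- Conservation of mass: the dormant mass changes by the active periods that end and the
dormant periods that end. -/
lemma dormantMass_add_lconvolution (hβ : 0 < β) [SFinite ρ] (t : ℝ) :
    dormantMass β ρ t + ENNReal.ofReal β * (unitStep ⋆ₗ dormantMass β ρ) t =
      unitStep t + ENNReal.ofReal β * (unitStep ⋆ₗ shiftAverage ρ (dormantMass β ρ)) t := by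
  set b := ENNReal.ofReal β
  set h := dormantMass β ρ
  set r := shiftAverage ρ h
  have hD := measurable_exponentialPDF β
  have hh : Measurable h := measurable_dormantMass
  have hr : Measurable r := measurable_shiftAverage hh
  have e0 : ∀ (v : ℝ → ℝ≥0∞), Measurable v → ∀ s, (exponentialPDF β ⋆ₗ v) s =
      b * (survival β ⋆ₗ v) s := fun v hv s => by
    simp only [lconvolution_def, exponentialPDF_eq_mul_survival hβ, mul_assoc]
    exact lintegral_const_mul _ (by fun_prop)
  -- The identity combines two renewal equations, for `h` and for `unitStep`, with the fact that the
  -- exponential density is `b` times `survival β`. It is kept additive on both sides to avoid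
  -- subtraction in `ℝ≥0∞`.
  have e1 : h = survival β + exponentialPDF β ⋆ₗ r := funext fun s => dormantMass_eq s
  have hθ := survival_add_lconvolution hβ
  have e2 : (unitStep ⋆ₗ h) t =
      (unitStep ⋆ₗ survival β) t + ((exponentialPDF β ⋆ₗ unitStep) ⋆ₗ r) t := by
    rw [e1, lconvolution_add _ _ _ (by fun_prop) (by fun_prop), lconvolution_assoc (by fun_prop)
      hD hr, lconvolution_comm (f := unitStep) (g := exponentialPDF β)]
  have e3 : b * (unitStep ⋆ₗ survival β) t = (exponentialPDF β ⋆ₗ unitStep) t := by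
    rw [lconvolution_comm, e0 _ (by fun_prop)]
  have e4 : (unitStep ⋆ₗ r) t =
      (survival β ⋆ₗ r) t + ((exponentialPDF β ⋆ₗ unitStep) ⋆ₗ r) t := by
    conv_lhs => rw [← hθ]
    exact add_lconvolution _ _ _ (by fun_prop) hr t
  have e5 : h t = survival β t + b * (survival β ⋆ₗ r) t := by
    rw [← e0 r hr]; exact congrFun e1 t
  have e6 : unitStep t = survival β t + (exponentialPDF β ⋆ₗ unitStep) t := (congrFun hθ t).symm
  rw [e2, mul_add, e3, e4, mul_add, e5, e6]
  ring

lemma unitStep_lconvolution_shiftAverage [SFinite ρ] {v : ℝ → ℝ≥0∞} (hv : Measurable v) (t : ℝ) :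
    (unitStep ⋆ₗ shiftAverage ρ v) t = (shiftAverage ρ unitStep ⋆ₗ v) t := by
  simp only [lconvolution_def, shiftAverage]
  calc _ = ∫⁻ y, ∫⁻ a, unitStep y * v (-y + t - a) ∂ρ :=
        lintegral_congr fun y => (lintegral_const_mul _ (by fun_prop)).symm
    _ = ∫⁻ a, (∫⁻ y, unitStep y * v (-y + t - a)) ∂ρ := lintegral_lintegral_swap (by fun_prop)
    _ = ∫⁻ a, (∫⁻ y, unitStep (y - a) * v (-y + t)) ∂ρ := by
        refine lintegral_congr fun a => ?_
        rw [← lintegral_sub_right_eq_self _ a]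
        refine lintegral_congr fun y => ?_
        ring_nf
    _ = ∫⁻ y, (∫⁻ a, unitStep (y - a) * v (-y + t) ∂ρ) :=
        lintegral_lintegral_swap (by fun_prop)
    _ = _ := lintegral_congr fun y => lintegral_mul_const _ (by fun_prop)

/-- The mass of the active periods that last longer than `y`, where the defect of `ρ` is
interpreted as the mass of infinite active periods. -/
def activeTail (ρ : Measure ℝ) : ℝ → ℝ≥0∞ :=
  (Set.Ici 0).indicator fun y => 1 - ρ (Set.Iic y)

@[fun_prop]
lemma measurable_activeTail : Measurable (activeTail ρ) := by
  refine Measurable.indicator (measurable_const.sub ?_) measurableSet_Ici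
  have : Monotone fun y => ρ (Set.Iic y) := fun a b hab => measure_mono (Set.Iic_subset_Iic.2 hab)
  exact this.measurable

lemma activeTail_le_one (y : ℝ) : activeTail ρ y ≤ 1 := by
  rcases lt_or_ge y 0 with h | h
  · simp [activeTail, h]
  · simp [activeTail, h]

lemma shiftAverage_unitStep_add_activeTail (hρ : ∀ᵐ a ∂ρ, 0 < a) (hm : ρ Set.univ ≤ 1) :
    shiftAverage ρ unitStep + activeTail ρ = unitStep := by
  ext y
  rw [Pi.add_apply]
  rcases lt_or_ge y 0 with h | h
  · rw [shiftAverage_of_nonpos hρ (fun t ht => unitStep_of_neg ht) h.le, unitStep_of_neg h]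
    simp [activeTail, h]
  · have : shiftAverage ρ unitStep y = ρ (Set.Iic y) := by
      rw [shiftAverage, ← lintegral_indicator_one measurableSet_Iic]
      refine lintegral_congr fun a => ?_
      rw [Set.indicator_apply]
      split_ifs with ha
      · exact unitStep_of_nonneg (sub_nonneg.2 ha)
      · exact unitStep_of_neg (sub_neg.2 (not_le.1 ha))
    rw [this, unitStep_of_nonneg h, activeTail,
      Set.indicator_of_mem (Set.mem_Ici.2 h)]
    exact add_tsub_cancel_of_le ((measure_mono (Set.subset_univ _)).trans hm)

/-- At time `t ≥ 0`, the system is either dormant or in an active period. -/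
lemma dormantMass_add_lconvolution_activeTail (hβ : 0 < β) [SFinite ρ] (hρ : ∀ᵐ a ∂ρ, 0 < a)
    (hm : ρ Set.univ ≤ 1) {t : ℝ} (ht : 0 ≤ t) :
    dormantMass β ρ t + ENNReal.ofReal β * (activeTail ρ ⋆ₗ dormantMass β ρ) t = 1 := by
  have h1 := dormantMass_add_lconvolution (ρ := ρ) hβ t
  rw [unitStep_lconvolution_shiftAverage measurable_dormantMass] at h1
  have hR : Measurable (shiftAverage ρ unitStep) := by fun_prop
  have h2 : (unitStep ⋆ₗ dormantMass β ρ) t = (shiftAverage ρ unitStep ⋆ₗ dormantMass β ρ) t +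
      (activeTail ρ ⋆ₗ dormantMass β ρ) t := by
    conv_lhs => rw [← shiftAverage_unitStep_add_activeTail hρ hm]
    exact add_lconvolution _ _ _ hR measurable_dormantMass t
  -- Finiteness permits cancelling this term from both sides of the conservation law.
  have hfin : (shiftAverage ρ unitStep ⋆ₗ dormantMass β ρ) t ≠ ∞ := by
    refine ne_top_of_le_ne_top (b := volume (Set.Icc 0 t)) (by simp) ?_
    rw [← lintegral_indicator_one measurableSet_Icc]
    refine lintegral_mono fun y => ?_
    rcases lt_or_ge y 0 with h | h
    · rw [shiftAverage_of_nonpos hρ (fun t ht => unitStep_of_neg ht) h.le]; simp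
    rcases lt_or_ge t y with h' | h'
    · rw [dormantMass_of_neg hρ (t := -y + t) (by linarith)]; simp
    · rw [Set.indicator_of_mem (Set.mem_Icc.2 ⟨h, h'⟩)]
      exact mul_le_one' ((shiftAverage_unitStep_le hρ hm y).trans (unitStep_le_one y))
        (dormantMass_le_one hβ hρ hm _)
  rw [h2, mul_add, unitStep_of_nonneg ht, add_comm (ENNReal.ofReal β * _), ← add_assoc] at h1
  exact (ENNReal.add_left_inj (ENNReal.mul_ne_top ENNReal.ofReal_ne_top hfin)).1 h1

/-- The first sequence is near its lower limit infinitely often, and the second is eventually below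
its upper limit up to `ε`. -/
lemma liminf_add_le_liminf_add_limsup {u v : ℕ → ℝ≥0∞} :
    liminf (fun n => u n + v n) atTop ≤ liminf u atTop + limsup v atTop := by
  refine ENNReal.le_of_forall_pos_le_add fun ε hε hlt => ?_
  obtain ⟨h1, h2⟩ := ENNReal.add_lt_top.1 hlt
  have hε' : (ε / 2 : ℝ≥0∞) ≠ 0 := by simpa using hε.ne'
  have f1 : ∃ᶠ n in atTop, u n < liminf u atTop + ε / 2 :=
    frequently_lt_of_liminf_lt (by isBoundedDefault) (ENNReal.lt_add_right h1.ne hε')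
  have f2 : ∀ᶠ n in atTop, v n < limsup v atTop + ε / 2 :=
    eventually_lt_of_limsup_lt (ENNReal.lt_add_right h2.ne hε')
  refine liminf_le_of_frequently_le' ((f1.and_eventually f2).mono fun n hn => ?_)
  calc u n + v n ≤ (liminf u atTop + ε / 2) + (limsup v atTop + ε / 2) :=
        add_le_add hn.1.le hn.2.le
    _ = liminf u atTop + limsup v atTop + (ε / 2 + ε / 2) := by ring
    _ = _ := by rw [ENNReal.add_halves]

/-- Along times at which the dormant mass approaches its limes superior, it also does so at the
translated times. -/
lemma limsup_le_liminf_sub (hβ : 0 < β) [SFinite ρ] (hρ : ∀ᵐ a ∂ρ, 0 < a) (hm : ρ Set.univ ≤ 1)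
    {T : ℕ → ℝ} (hT : Tendsto T atTop atTop)
    (hc : limsup (dormantMass β ρ) atTop ≤ liminf (fun k => dormantMass β ρ (T k)) atTop)
    {y : ℝ} (hy : 0 ≤ y) :
    limsup (dormantMass β ρ) atTop ≤ liminf (fun k => dormantMass β ρ (-y + T k)) atTop := by
  set c := limsup (dormantMass β ρ) atTop with hcdef
  have hc1 : c ≤ 1 := limsup_le_of_le (by isBoundedDefault)
    (Eventually.of_forall fun t => dormantMass_le_one hβ hρ hm t)
  have hD := measurable_exponentialPDF β
  have hlim : ∀ z, limsup (fun k => dormantMass β ρ (z + T k)) atTop ≤ c := fun z => by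
    have : Tendsto (fun k => z + T k) atTop atTop := tendsto_atTop_add_const_left _ _ hT
    exact limsup_le_limsup_of_le (u := dormantMass β ρ) this
  have hm' : Measurable (dormantMass β ρ) := measurable_dormantMass
  have hR : Measurable (shiftAverage ρ (dormantMass β ρ)) := by fun_prop
  have hR1 : ∀ s, shiftAverage ρ (dormantMass β ρ) s ≤ 1 := fun s =>
    (lintegral_mono fun a => dormantMass_le_one hβ hρ hm _).trans (by simpa using hm)
  have hlimR : ∀ z, limsup (fun k => shiftAverage ρ (dormantMass β ρ) (z + T k)) atTop ≤ c := by
    intro z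
    refine (limsup_lintegral_le (fun _ => 1) (fun n => by fun_prop) (fun n => ae_of_all _ fun a =>
      dormantMass_le_one hβ hρ hm _) (by simpa using (hm.trans_lt ENNReal.one_lt_top).ne)).trans ?_
    calc _ ≤ ∫⁻ _, c ∂ρ := by
          refine lintegral_mono fun a => ?_
          have := hlim (z - a)
          simpa only [sub_add_eq_add_sub] using this
      _ ≤ c := by
          rw [lintegral_const]
          exact mul_le_of_le_one_right' hm
  have hsum := survival_add_lintegral_exponentialPDF hβ hy
  rw [← setLIntegral_congr Iio_ae_eq_Iic] at hsum
  set q := ∫⁻ z in Set.Iio y, exponentialPDF β z with hq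
  have hq1 : q ≤ 1 := hsum ▸ le_add_self
  have hlimX : limsup (fun k => ∫⁻ z in Set.Iio y, exponentialPDF β z *
      shiftAverage ρ (dormantMass β ρ) (-z + T k)) atTop ≤ q * c := by
    refine (limsup_lintegral_le (fun z => exponentialPDF β z) (fun n => by fun_prop)
      (fun n => ae_of_all _ fun a => mul_le_of_le_one_right' (hR1 _))
      (hq1.trans_lt ENNReal.one_lt_top).ne).trans ?_
    rw [hq, ← lintegral_mul_const _ hD]
    refine lintegral_mono fun z => ?_
    have hz : exponentialPDF β z ≠ ∞ := ENNReal.ofReal_ne_top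
    rw [ENNReal.limsup_const_mul_of_ne_top hz]
    gcongr
    exact hlimR _
  have hsplit : ∀ᶠ k in atTop, dormantMass β ρ (T k) = survival β y * dormantMass β ρ (-y + T k) +
      ∫⁻ z in Set.Iio y, exponentialPDF β z * shiftAverage ρ (dormantMass β ρ) (-z + T k) := by
    filter_upwards [hT.eventually_ge_atTop y] with k hk
    have := dormantMass_add (ρ := ρ) hβ hy (t := -y + T k) (by linarith)
    simpa only [add_neg_cancel_left] using this
  have hs0 : survival β y ≠ 0 := by
    rw [survival_of_nonneg hy]
    simpa using Real.exp_pos _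
  -- The weights `survival β y` and `q` add up to `1`. The part weighted by `q` contributes at most
  -- `q * c`, so the other part must supply all of `survival β y * c`.
  have h1 : c ≤ survival β y * liminf (fun k => dormantMass β ρ (-y + T k)) atTop + q * c := by
    refine hc.trans ?_
    rw [liminf_congr hsplit]
    refine liminf_add_le_liminf_add_limsup.trans ?_
    rw [ENNReal.liminf_const_mul_of_ne_zero_of_ne_top hs0 (survival_ne_top y)]
    gcongr
  have h2 : survival β y * c + q * c = c := by rw [← add_mul, hsum, one_mul]
  have h3 : survival β y * c ≤ survival β y * liminf (fun k => dormantMass β ρ (-y + T k)) atTop := by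
    conv_lhs at h1 => rw [← h2]
    exact (ENNReal.add_le_add_iff_right (ENNReal.mul_ne_top (hq1.trans_lt ENNReal.one_lt_top).ne
      (hc1.trans_lt ENNReal.one_lt_top).ne)).1 h1
  exact (ENNReal.mul_le_mul_iff_right hs0 (survival_ne_top y)).1 h3

/-- The dormant mass vanishes in the limit if active periods have infinite mean. -/
lemma tendsto_dormantMass_zero (hβ : 0 < β) [SFinite ρ] (hρ : ∀ᵐ a ∂ρ, 0 < a)
    (hm : ρ Set.univ ≤ 1) (htail : ∫⁻ y, activeTail ρ y = ∞) :
    Tendsto (dormantMass β ρ) atTop (𝓝 0) := by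
  set c := limsup (dormantMass β ρ) atTop with hcdef
  suffices c = 0 from tendsto_of_le_liminf_of_limsup_le (by simp) this.le
  by_contra hc0
  have hc1 : c ≤ 1 := limsup_le_of_le (by isBoundedDefault)
    (Eventually.of_forall fun t => dormantMass_le_one hβ hρ hm t)
  have hct : c ≠ ∞ := (hc1.trans_lt ENNReal.one_lt_top).ne
  have hex : ∀ k : ℕ, ∃ t : ℝ, c - ((k : ℝ≥0∞) + 1)⁻¹ < dormantMass β ρ t ∧ (k : ℝ) ≤ t := fun k =>
    ((frequently_lt_of_lt_limsup (by isBoundedDefault) (ENNReal.sub_lt_self hct hc0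
      (by simp))).and_eventually (eventually_ge_atTop (k : ℝ))).exists
  choose T hT1 hT2 using hex
  have hT : Tendsto T atTop atTop := tendsto_atTop_mono hT2 tendsto_natCast_atTop_atTop
  have hlim : Tendsto (fun k : ℕ => c - ((k : ℝ≥0∞) + 1)⁻¹) atTop (𝓝 c) := by
    have : Tendsto (fun k : ℕ => ((k : ℝ≥0∞) + 1)⁻¹) atTop (𝓝 0) := by
      have := (tendsto_add_atTop_iff_nat 1).2 ENNReal.tendsto_inv_nat_nhds_zero
      simpa using this
    simpa using ENNReal.Tendsto.sub tendsto_const_nhds this (Or.inl hct)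
  have hc : c ≤ liminf (fun k => dormantMass β ρ (T k)) atTop := by
    rw [← hlim.liminf_eq]
    exact liminf_le_liminf (Eventually.of_forall fun k => (hT1 k).le)
  have hle : ∀ᶠ k in atTop, ENNReal.ofReal β * (activeTail ρ ⋆ₗ dormantMass β ρ) (T k) ≤ 1 := by
    filter_upwards [hT.eventually_ge_atTop 0] with k hk
    rw [← dormantMass_add_lconvolution_activeTail hβ hρ hm hk]
    exact le_add_self
  have hb : ENNReal.ofReal β ≠ 0 := by simpa using hβ
  have hm' : Measurable (dormantMass β ρ) := measurable_dormantMass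
  -- Fatou's lemma, with the lower bound `c` at each translated time; the left side is infinite,
  -- whereas the right side is bounded by `hle`.
  have hF : ∫⁻ y, activeTail ρ y * c ≤
      liminf (fun k => (activeTail ρ ⋆ₗ dormantMass β ρ) (T k)) atTop := by
    simp only [lconvolution_def]
    refine le_trans (lintegral_mono fun y => ?_) (lintegral_liminf_le fun k => by fun_prop)
    rcases lt_or_ge y 0 with h | h
    · simp [activeTail, h]
    rcases eq_or_ne (activeTail ρ y) 0 with h0 | h0
    · simp [h0]
    rw [ENNReal.liminf_const_mul_of_ne_zero_of_ne_top h0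
      ((activeTail_le_one y).trans_lt ENNReal.one_lt_top).ne]
    gcongr
    exact limsup_le_liminf_sub hβ hρ hm hT hc h
  rw [lintegral_mul_const _ measurable_activeTail, htail, ENNReal.top_mul hc0, top_le_iff] at hF
  have := liminf_le_of_frequently_le' hle.frequently
  rw [ENNReal.liminf_const_mul_of_ne_zero_of_ne_top hb ENNReal.ofReal_ne_top, hF,
    ENNReal.mul_top hb] at this
  simp at this

/-- The dormant mass stays away from `0` if active periods have finite mean. -/
lemma exists_pos_le_dormantMass (hβ : 0 < β) [SFinite ρ] (hρ : ∀ᵐ a ∂ρ, 0 < a)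
    (hm : ρ Set.univ ≤ 1) (htail : ∫⁻ y, activeTail ρ y ≠ ∞) :
    ∃ c : ℝ≥0∞, c ≠ 0 ∧ ∀ t, 0 ≤ t → c ≤ dormantMass β ρ t := by
  set b := ENNReal.ofReal β
  have hb : b ≠ 0 := by simpa [b] using hβ
  obtain ⟨M, hM0, hM⟩ : ∃ M : ℝ, 0 ≤ M ∧ ∫⁻ y in Set.Ioi M, activeTail ρ y ≤ b⁻¹ * 2⁻¹ := by
    set ν := volume.withDensity (activeTail ρ)
    have hν : ν Set.univ ≠ ∞ := by simpa [ν] using htail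
    have hlim := tendsto_measure_iInter_atTop (μ := ν) (s := fun n : ℕ => Set.Ioi (n : ℝ))
      (fun n => measurableSet_Ioi.nullMeasurableSet)
      (fun m n hmn => Set.Ioi_subset_Ioi (by exact_mod_cast hmn))
      ⟨0, ne_top_of_le_ne_top hν (measure_mono (Set.subset_univ _))⟩
    have hempty : ⋂ n : ℕ, Set.Ioi (n : ℝ) = ∅ := by
      refine Set.eq_empty_of_forall_notMem fun x hx => ?_
      obtain ⟨n, hn⟩ := exists_nat_ge x
      exact absurd (Set.mem_iInter.1 hx n) (not_lt.2 hn)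
    rw [hempty, measure_empty] at hlim
    have hpos : 0 < b⁻¹ * 2⁻¹ := ENNReal.mul_pos (ENNReal.inv_ne_zero.2 ENNReal.ofReal_ne_top)
      (by simp)
    obtain ⟨n, hn⟩ := (hlim.eventually (gt_mem_nhds hpos)).exists
    refine ⟨n, n.cast_nonneg, ?_⟩
    rw [← withDensity_apply _ measurableSet_Ioi]
    exact hn.le
  -- In the balance equation, lags `y ≤ M` contribute at most `b * e * M` times the mass at `t`,
  -- because surviving for time `y` costs a factor `exp(-βy)`. Lags `y > M` contribute at most `1/2`
  -- by the choice of `M`. Hence `1 ≤ C * dormantMass β ρ t + 1/2`.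
  set e := ENNReal.ofReal (Real.exp (β * M))
  set C := 1 + b * (e * ENNReal.ofReal M) with hC
  have hCt : C ≠ ∞ := by finiteness
  refine ⟨2⁻¹ * C⁻¹, by simp [hCt], fun t ht => ?_⟩
  have hmax : ∀ y, 0 ≤ y → y ≤ M → dormantMass β ρ (-y + t) ≤ e * dormantMass β ρ t := by
    intro y hy hyM
    rcases lt_or_ge (-y + t) 0 with h | h
    · rw [dormantMass_of_neg hρ h]; exact zero_le
    · have h1 := survival_mul_dormantMass_le hβ hρ hy h
      rw [add_neg_cancel_left, survival_of_nonneg hy] at h1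
      calc dormantMass β ρ (-y + t) = ENNReal.ofReal (Real.exp (β * y)) *
            (ENNReal.ofReal (Real.exp (-(β * y))) * dormantMass β ρ (-y + t)) := by
            rw [← mul_assoc, ← ENNReal.ofReal_mul (Real.exp_pos _).le, ← Real.exp_add]; simp
        _ ≤ e * dormantMass β ρ t := by
            refine mul_le_mul' (ENNReal.ofReal_le_ofReal (Real.exp_le_exp.2 ?_)) h1
            gcongr
  have hconv : (activeTail ρ ⋆ₗ dormantMass β ρ) t ≤
      e * dormantMass β ρ t * ENNReal.ofReal M + b⁻¹ * 2⁻¹ := by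
    rw [lconvolution_def, ← lintegral_add_compl _ (measurableSet_Iic (a := M)), Set.compl_Iic]
    refine add_le_add ?_ ((lintegral_mono fun y => ?_).trans hM)
    · calc _ ≤ ∫⁻ y in Set.Iic M, (Set.Ici 0).indicator (fun _ => e * dormantMass β ρ t) y := by
            refine setLIntegral_mono (measurable_const.indicator measurableSet_Ici) fun y hy => ?_
            rw [Set.indicator_apply]
            split_ifs with h
            · calc _ ≤ 1 * dormantMass β ρ (-y + t) := by gcongr; exact activeTail_le_one y
                _ ≤ _ := by rw [one_mul]; exact hmax y h hy
            · rw [activeTail, Set.indicator_of_notMem h, zero_mul]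
        _ = _ := by
            rw [lintegral_indicator measurableSet_Ici, setLIntegral_const,
              Measure.restrict_apply measurableSet_Ici, Set.Ici_inter_Iic, Real.volume_Icc, sub_zero]
    · exact mul_le_of_le_one_right' (dormantMass_le_one hβ hρ hm _)
  have h1 : 1 ≤ C * dormantMass β ρ t + 2⁻¹ := by
    calc (1 : ℝ≥0∞) = _ := (dormantMass_add_lconvolution_activeTail hβ hρ hm ht).symm
      _ ≤ dormantMass β ρ t + b * (e * dormantMass β ρ t * ENNReal.ofReal M + b⁻¹ * 2⁻¹) := by gcongr
      _ = C * dormantMass β ρ t + b * b⁻¹ * 2⁻¹ := by rw [hC]; ring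
      _ = _ := by rw [ENNReal.mul_inv_cancel hb ENNReal.ofReal_ne_top, one_mul]
  have h2 : 2⁻¹ ≤ C * dormantMass β ρ t := by
    have h3 : (2⁻¹ : ℝ≥0∞) + 2⁻¹ ≤ C * dormantMass β ρ t + 2⁻¹ := by
      rwa [ENNReal.inv_two_add_inv_two]
    exact (ENNReal.add_le_add_iff_right (by simp)).1 h3
  calc 2⁻¹ * C⁻¹ ≤ C * dormantMass β ρ t * C⁻¹ := by gcongr
    _ = C * C⁻¹ * dormantMass β ρ t := by ring
    _ = _ := by rw [ENNReal.mul_inv_cancel (by simp [hC]) hCt, one_mul]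

end SubProbability

/-- The layer-cake formula. -/
lemma lintegral_activeTail {ρ : Measure ℝ} (hρ : ∀ᵐ a ∂ρ, 0 < a) (hm : ρ Set.univ = 1) :
    ∫⁻ y, activeTail ρ y = ∫⁻ a, ENNReal.ofReal a ∂ρ := by
  have : IsProbabilityMeasure ρ := ⟨hm⟩
  rw [lintegral_eq_lintegral_meas_lt ρ (hρ.mono fun a ha => ha.le) aemeasurable_id,
    activeTail, lintegral_indicator measurableSet_Ici, setLIntegral_congr Ioi_ae_eq_Ici.symm]
  refine lintegral_congr fun y => ?_
  rw [← prob_compl_eq_one_sub measurableSet_Iic, Set.compl_Iic]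
  rfl

/-- The tail never drops below the defect `1 - ρ univ`. -/
lemma lintegral_activeTail_of_lt {ρ : Measure ℝ} (hm : ρ Set.univ < 1) :
    ∫⁻ y, activeTail ρ y = ∞ := by
  rw [activeTail, lintegral_indicator measurableSet_Ici, ← top_le_iff]
  calc ∞ = ∫⁻ y in Set.Ici (0 : ℝ), (1 - ρ Set.univ) := by
        rw [setLIntegral_const, Real.volume_Ici, ENNReal.mul_top (tsub_pos_of_lt hm).ne']
    _ ≤ _ := by
        refine lintegral_mono fun y => ?_
        exact tsub_le_tsub_left (measure_mono (Set.subset_univ _)) _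

/-! ### Exponential growth rates. -/

lemma log_ofReal_exp (r : ℝ) : ENNReal.log (ENNReal.ofReal (Real.exp r)) = r := by
  rw [← EReal.exp_coe, EReal.log_exp]

lemma le_log_div_iff {x : ℝ≥0∞} {t : ℝ} (ht : 0 < t) (c : ℝ) :
    (c : EReal) ≤ ENNReal.log x / t ↔ ENNReal.ofReal (Real.exp (c * t)) ≤ x := by
  rw [EReal.le_div_iff_mul_le (by exact_mod_cast ht) (EReal.coe_ne_top t),
    ← ENNReal.log_le_log_iff, log_ofReal_exp, EReal.coe_mul]

lemma log_div_le_iff {x : ℝ≥0∞} {t : ℝ} (ht : 0 < t) (c : ℝ) :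
    ENNReal.log x / t ≤ c ↔ x ≤ ENNReal.ofReal (Real.exp (c * t)) := by
  rw [EReal.div_le_iff_le_mul (by exact_mod_cast ht) (EReal.coe_ne_top t),
    ← ENNReal.log_le_log_iff, log_ofReal_exp, ← EReal.coe_mul, mul_comm]

/-- Fekete's lemma on the half-line, for the exponential growth rate of a supermultiplicative
function and of any function that is comparable to it. -/
lemma exists_tendsto_log_div {g Z : ℝ → ℝ≥0∞} {α : ℝ} {C : ℝ≥0∞} (hC : C ≠ ∞)
    (hmul : ∀ s t, 0 ≤ s → 0 ≤ t → g s * g t ≤ g (s + t))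
    (hlow : ∀ t, 0 ≤ t → ENNReal.ofReal (Real.exp (-(α * t))) ≤ g t)
    (hgZ : ∀ t, 0 < t → g t ≤ Z t) (hZg : ∀ t, 0 < t → Z t ≤ C * g t) :
    ∃ φ : EReal, Tendsto (fun t : ℝ => ENNReal.log (Z t) / (t : EReal)) atTop (𝓝 φ) ∧ φ ≠ ⊥ ∧
      (∀ t : ℝ, 0 < t → ENNReal.log (g t) / (t : EReal) ≤ φ) ∧
      ∀ l : ℝ, (∀ t, 0 < t → g t ≤ ENNReal.ofReal (Real.exp (l * t))) → φ ≤ l := by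
  set φ : EReal := ⨆ t : Set.Ioi (0 : ℝ), ENNReal.log (g t) / ((t : ℝ) : EReal) with hφ
  have hle : ∀ t : ℝ, 0 < t → ENNReal.log (g t) / (t : EReal) ≤ φ := fun t ht =>
    le_iSup (fun t : Set.Ioi (0 : ℝ) => ENNReal.log (g t) / ((t : ℝ) : EReal)) ⟨t, ht⟩
  have hpow : ∀ s, 0 ≤ s → ∀ n : ℕ, 0 < n → g s ^ n ≤ g (n * s) := by
    intro s hs n hn
    induction n, hn using Nat.le_induction with
    | base => simp
    | succ n hn ih =>
      rw [pow_succ]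
      calc g s ^ n * g s ≤ g (n * s) * g s := by gcongr
        _ ≤ g (n * s + s) := hmul _ _ (by positivity) hs
        _ = _ := by push_cast; ring_nf
  refine ⟨φ, ?_, ?_, hle, fun l hl => iSup_le fun t => (log_div_le_iff t.2 l).2 (hl t t.2)⟩
  · refine tendsto_order.2 ⟨fun a ha => ?_, fun a ha => ?_⟩
    · obtain ⟨⟨t₀, ht₀⟩, h0⟩ := lt_iSup_iff.1 ha
      obtain ⟨b, hab, hb⟩ := EReal.lt_iff_exists_real_btwn.1 h0
      obtain ⟨a', haa', ha'b⟩ := EReal.lt_iff_exists_real_btwn.1 hab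
      have ha'b : a' < b := by exact_mod_cast ha'b
      replace ht₀ : 0 < t₀ := ht₀
      have hgt₀ := (le_log_div_iff ht₀ b).1 hb.le
      -- Writing `t = n t₀ + r` with `0 ≤ r < t₀`, the lower bound for `log g(t)` is `b n t₀ - α r ≥
      -- b t - (|b| + |α|) t₀`, which must exceed `a' t`.
      have hlarge : ∀ᶠ t : ℝ in atTop, (|b| + |α|) * t₀ ≤ (b - a') * t :=
        (tendsto_id.const_mul_atTop (sub_pos.2 ha'b)).eventually_ge_atTop _
      filter_upwards [hlarge, eventually_ge_atTop t₀] with t ht htt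
      refine haa'.trans_le ((le_log_div_iff (ht₀.trans_le htt) a').2
        (le_trans ?_ (hgZ t (ht₀.trans_le htt))))
      set n := ⌊t / t₀⌋₊ with hn
      have hn0 : 0 < n := Nat.floor_pos.2 ((one_le_div ht₀).2 htt)
      have hn1 : n * t₀ ≤ t := by
        rw [← le_div_iff₀ ht₀]; exact Nat.floor_le (div_nonneg (ht₀.le.trans htt) ht₀.le)
      have hn2 : t < (n + 1) * t₀ := by
        rw [← div_lt_iff₀ ht₀]; exact Nat.lt_floor_add_one _
      calc ENNReal.ofReal (Real.exp (a' * t))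
          ≤ ENNReal.ofReal (Real.exp (b * t₀ * n) * Real.exp (-(α * (t - n * t₀)))) := by
            rw [← Real.exp_add]
            refine ENNReal.ofReal_le_ofReal (Real.exp_le_exp.2 ?_)
            have h1 : b * (t - n * t₀) ≤ |b| * t₀ :=
              mul_le_mul (le_abs_self b) (by linarith) (by linarith) (abs_nonneg b)
            have h2 : α * (t - n * t₀) ≤ |α| * t₀ :=
              mul_le_mul (le_abs_self α) (by linarith) (by linarith) (abs_nonneg α)
            linarith
        _ = ENNReal.ofReal (Real.exp (b * t₀)) ^ n *
              ENNReal.ofReal (Real.exp (-(α * (t - n * t₀)))) := by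
            rw [ENNReal.ofReal_mul (Real.exp_pos _).le, ← ENNReal.ofReal_pow (Real.exp_pos _).le,
              ← Real.exp_nat_mul]
            ring_nf
        _ ≤ g t₀ ^ n * g (t - n * t₀) := by
            gcongr
            exact hlow _ (by linarith)
        _ ≤ g (n * t₀) * g (t - n * t₀) := by
            gcongr
            exact hpow _ ht₀.le n hn0
        _ ≤ g t := by
            convert hmul (n * t₀) (t - n * t₀) (by positivity) (by linarith) using 2
            ring
    · obtain ⟨a', ha', haa'⟩ := EReal.lt_iff_exists_real_btwn.1 ha
      obtain ⟨b, hb, hba'⟩ := EReal.lt_iff_exists_real_btwn.1 ha'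
      have hba' : b < a' := by exact_mod_cast hba'
      -- The gap between `b` and `a'` absorbs `C`, through `x + 1 ≤ exp x`.
      have hlarge : ∀ᶠ t : ℝ in atTop, C.toReal ≤ (a' - b) * t :=
        (tendsto_id.const_mul_atTop (sub_pos.2 hba')).eventually_ge_atTop _
      filter_upwards [hlarge, eventually_gt_atTop 0] with t ht ht0
      refine lt_of_le_of_lt ((log_div_le_iff ht0 a').2 ((hZg t ht0).trans ?_)) haa'
      have h1 := (log_div_le_iff ht0 b).1 ((hle t ht0).trans hb.le)
      calc C * g t ≤ ENNReal.ofReal (Real.exp ((a' - b) * t)) * ENNReal.ofReal (Real.exp (b * t)) := by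
            gcongr
            rw [← ENNReal.ofReal_toReal hC]
            refine ENNReal.ofReal_le_ofReal ?_
            have := Real.add_one_le_exp ((a' - b) * t)
            linarith
        _ = _ := by
            rw [← ENNReal.ofReal_mul (Real.exp_pos _).le, ← Real.exp_add]
            ring_nf
  · refine ne_bot_of_le_ne_bot (EReal.coe_ne_bot (-α)) (le_trans ?_ (hle 1 one_pos))
    exact (le_log_div_iff one_pos (-α)).2 (by simpa using hlow 1 zero_le_one)

/-! ### The growth rate and the mass of the tilted measure. -/

section Tilting

/-- The exponential tilting of the law of the active periods that corresponds to the tilting of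
the law of a cycle by `exp(-λ ·)`. -/
def tiltedMeasure (α : ℝ) (ρ : Measure ℝ) (lam : ℝ) : Measure ℝ :=
  ρ.withDensity fun a => ENNReal.ofReal (α / (α + lam) * Real.exp (-(lam * a)))

instance {α : ℝ} {ρ : Measure ℝ} [SFinite ρ] {lam : ℝ} : SFinite (tiltedMeasure α ρ lam) := by
  unfold tiltedMeasure; infer_instance

variable {α lam : ℝ} {ρ : Measure ℝ}

lemma ae_pos_tiltedMeasure (hρ : ∀ᵐ a ∂ρ, 0 < a) : ∀ᵐ a ∂tiltedMeasure α ρ lam, 0 < a :=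
  (withDensity_absolutelyContinuous _ _).ae_le hρ

lemma dormantMass_le_exp (hα : 0 < α) [SFinite ρ] (hρ : ∀ᵐ a ∂ρ, 0 < a) (hl : 0 < α + lam)
    (hm : tiltedMeasure α ρ lam Set.univ ≤ 1) (t : ℝ) :
    dormantMass α ρ t ≤ ENNReal.ofReal (Real.exp (lam * t)) := by
  have h := dormantMass_le_one hl (ae_pos_tiltedMeasure hρ) hm t
  rw [tiltedMeasure, ← exp_mul_dormantMass hα hl] at h
  calc dormantMass α ρ t = ENNReal.ofReal (Real.exp (lam * t)) *
        (ENNReal.ofReal (Real.exp (-(lam * t))) * dormantMass α ρ t) := by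
        rw [← mul_assoc, ← ENNReal.ofReal_mul (Real.exp_pos _).le, ← Real.exp_add]; simp
    _ ≤ _ := mul_le_of_le_one_right' h

lemma tendsto_dormantMass_mul_exp (hα : 0 < α) [SFinite ρ] (hρ : ∀ᵐ a ∂ρ, 0 < a)
    (hl : 0 < α + lam) (hm : tiltedMeasure α ρ lam Set.univ ≤ 1)
    (htail : ∫⁻ y, activeTail (tiltedMeasure α ρ lam) y = ∞) :
    Tendsto (fun t => ENNReal.ofReal (Real.exp (-(lam * t))) * dormantMass α ρ t) atTop (𝓝 0) := by
  simp only [exp_mul_dormantMass hα hl]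
  exact tendsto_dormantMass_zero hl (ae_pos_tiltedMeasure hρ) hm htail

/-- The trajectory without any completed cycle already has rate `-α`. Consequently `α + lam > 0` for
every `lam > φ`, as tilting requires. -/
lemma neg_le_of_dormantMass_le_exp [SFinite ρ] {φ : ℝ}
    (h : ∀ t, 0 < t → dormantMass α ρ t ≤ ENNReal.ofReal (Real.exp (φ * t))) : -α ≤ φ := by
  have h1 := (survival_le_dormantMass 1).trans (h 1 one_pos)
  rw [survival_of_nonneg zero_le_one, ENNReal.ofReal_le_ofReal_iff (Real.exp_pos _).le,
    Real.exp_le_exp] at h1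
  linarith

/-- The tilted dormant mass is dominated by `exp(-(lam - φ)t)`, hence integrable; by
`lintegral_dormantMass` its integral would be infinite if the tilted measure had mass at least `1`.
-/
lemma tiltedMeasure_univ_lt_one (hα : 0 < α) [SFinite ρ] (hρ : ∀ᵐ a ∂ρ, 0 < a) {φ : ℝ}
    (h : ∀ t, 0 < t → dormantMass α ρ t ≤ ENNReal.ofReal (Real.exp (φ * t))) (hl : φ < lam) :
    tiltedMeasure α ρ lam Set.univ < 1 := by
  have hl' : 0 < α + lam := by linarith [neg_le_of_dormantMass_le_exp h]
  have h1 := lintegral_dormantMass (ρ := tiltedMeasure α ρ lam) hl'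
  have h2 : ∫⁻ t, dormantMass (α + lam) (tiltedMeasure α ρ lam) t ≤ ∫⁻ t, survival (lam - φ) t := by
    refine lintegral_mono_ae ?_
    filter_upwards [Measure.ae_ne volume (0 : ℝ)] with t ht
    rcases lt_or_gt_of_ne ht with ht | ht
    · rw [dormantMass_of_neg (ae_pos_tiltedMeasure hρ) ht]; exact zero_le
    · rw [tiltedMeasure, ← exp_mul_dormantMass hα hl', survival_of_nonneg ht.le]
      calc _ ≤ ENNReal.ofReal (Real.exp (-(lam * t))) * ENNReal.ofReal (Real.exp (φ * t)) := by
            gcongr; exact h t ht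
        _ = _ := by
            rw [← ENNReal.ofReal_mul (Real.exp_pos _).le, ← Real.exp_add]; ring_nf
  rw [h1, lintegral_survival (sub_pos.2 hl)] at h2
  by_contra hge
  rw [tsub_eq_zero_of_le (not_lt.1 hge), ENNReal.inv_zero, ENNReal.mul_top (by simp), top_le_iff,
    ENNReal.inv_eq_top, ENNReal.ofReal_eq_zero] at h2
  linarith

end Tilting

/-! ### Independence of the cycles. -/

section Independence

variable {Ω X : Type*} [MeasurableSpace Ω] [MeasurableSpace X]
  {P : Measure Ω} {α : ℝ} {Ξ : Measure (ℝ × X)}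
  {d a : ℕ → Ω → ℝ} {χ : ℕ → Ω → X}

/-- Two independent families, each of which consists of independent random variables, form an
independent family of pairs. -/
lemma iIndepFun_prodMk_of_indepFun [IsProbabilityMeasure P] 
    {ι β γ : Type*} [MeasurableSpace β] [MeasurableSpace γ]
    {f : ι → Ω → β} {g : ι → Ω → γ} (hf : ∀ i, Measurable (f i)) (hg : ∀ i, Measurable (g i))
    (hfi : iIndepFun f P) (hgi : iIndepFun g P)
    (hfg : IndepFun (fun ω i => f i ω) (fun ω i => g i ω) P) :
    iIndepFun (fun i ω => (f i ω, g i ω)) P := by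
  -- Preimages of rectangles form a generating π-system, on which the three independence assumptions
  -- factor the probabilities.
  set π : ι → Set (Set Ω) := fun i =>
    (fun s => (fun ω => (f i ω, g i ω)) ⁻¹' s) ''
      (Set.image2 (· ×ˢ ·) {s | MeasurableSet s} {t | MeasurableSet t}) with hπ
  refine iIndepSets.iIndep (fun i => ((hf i).prodMk (hg i)).comap_le) π
    (fun i => ?_) (fun i => ?_) ?_
  · exact isPiSystem_prod.comap _
  · rw [← generateFrom_prod, MeasurableSpace.comap_generateFrom]
  · rw [iIndepSets_iff]
    intro s A hA
    have hA' : ∀ i ∈ s, ∃ B : Set β, ∃ C : Set γ, MeasurableSet B ∧ MeasurableSet C ∧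
        A i = f i ⁻¹' B ∩ g i ⁻¹' C := by
      intro i hi
      obtain ⟨_, ⟨B, hB, C, hC, rfl⟩, h⟩ := hA i hi
      exact ⟨B, C, hB, hC, h.symm⟩
    choose! B C hB hC hABC using hA'
    have e1 : ⋂ i ∈ s, A i = (⋂ i ∈ s, f i ⁻¹' B i) ∩ ⋂ i ∈ s, g i ⁻¹' C i := by
      ext ω
      simp only [Set.mem_iInter, Set.mem_inter_iff]
      constructor
      · intro h
        refine ⟨fun i hi => ?_, fun i hi => ?_⟩ <;> have := h i hi <;> rw [hABC i hi] at this
        exacts [this.1, this.2]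
      · rintro ⟨h1, h2⟩ i hi
        rw [hABC i hi]
        exact ⟨h1 i hi, h2 i hi⟩
    have e2 := hfg.measure_inter_preimage_eq_mul (⋂ i ∈ s, (fun x => x i) ⁻¹' B i)
      (⋂ i ∈ s, (fun x => x i) ⁻¹' C i)
      (s.measurableSet_biInter fun i hi => (measurable_pi_apply i) (hB i hi))
      (s.measurableSet_biInter fun i hi => (measurable_pi_apply i) (hC i hi))
    simp only [Set.preimage_iInter] at e2
    rw [e1]
    refine e2.trans ?_
    have e3 := hfi.measure_inter_preimage_eq_mul s (sets := B) hB
    have e4 := hgi.measure_inter_preimage_eq_mul s (sets := C) hC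
    refine (congrArg₂ (· * ·) e3 e4).trans ?_
    rw [← Finset.prod_mul_distrib]
    refine Finset.prod_congr rfl fun i hi => ?_
    rw [hABC i hi]
    exact ((hfg.comp (measurable_pi_apply i) (measurable_pi_apply i)).measure_inter_preimage_eq_mul
      _ _ (hB i hi) (hC i hi)).symm

lemma lintegral_comp_of_indepFun [IsProbabilityMeasure P] 
    {β γ : Type*} [MeasurableSpace β] [MeasurableSpace γ]
    {Y : Ω → β} {Z : Ω → γ} (hY : Measurable Y) (hZ : Measurable Z) (h : IndepFun Y Z P)
    {U : β → γ → ℝ≥0∞} (hU : Measurable (Function.uncurry U)) :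
    ∫⁻ ω, U (Y ω) (Z ω) ∂P = ∫⁻ ω, (∫⁻ z, U (Y ω) z ∂(P.map Z)) ∂P := by
  have := Measure.isProbabilityMeasure_map (μ := P) hZ.aemeasurable
  have h1 := h.map_prod_eq_prod_map_map hY.aemeasurable hZ.aemeasurable
  calc ∫⁻ ω, U (Y ω) (Z ω) ∂P = ∫⁻ p, Function.uncurry U p ∂(P.map fun ω => (Y ω, Z ω)) :=
        (lintegral_map hU (hY.prodMk hZ)).symm
    _ = ∫⁻ y, (∫⁻ z, U y z ∂(P.map Z)) ∂(P.map Y) := by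
        rw [h1, lintegral_prod _ hU.aemeasurable]; rfl
    _ = _ := lintegral_map hU.lintegral_prod_right' hY

/-- The dormant period, active period and state number `n + 1`. -/
def cycle (d a : ℕ → Ω → ℝ) (χ : ℕ → Ω → X) (n : ℕ) (ω : Ω) : ℝ × ℝ × X :=
  (d n ω, a n ω, χ n ω)

namespace IsAlternatingSequence

lemma measurable_cycle
    (h : IsAlternatingSequence P α Ξ d a χ) (n : ℕ) : Measurable (cycle d a χ n) :=
  (h.measurable_d n).prodMk ((h.measurable_a n).prodMk (h.measurable_χ n))

lemma iIndepFun_cycle [IsProbabilityMeasure P] 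
    (h : IsAlternatingSequence P α Ξ d a χ) : iIndepFun (cycle d a χ) P :=
  iIndepFun_prodMk_of_indepFun h.measurable_d
    (fun n => (h.measurable_a n).prodMk (h.measurable_χ n)) h.indep_d h.indep_aχ h.indep_d_aχ

lemma map_cycle [IsProbabilityMeasure P] 
    (h : IsAlternatingSequence P α Ξ d a χ) (n : ℕ) : P.map (cycle d a χ n) = (expMeasure α).prod Ξ := by
  have h1 : IndepFun (d n) (fun ω => (a n ω, χ n ω)) P :=
    h.indep_d_aχ.comp (measurable_pi_apply n) (measurable_pi_apply n)
  have h2 := h1.map_prod_eq_prod_map_map (h.measurable_d n).aemeasurable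
    ((h.measurable_a n).prodMk (h.measurable_χ n)).aemeasurable
  rw [h.law_d, h.law_aχ] at h2
  exact h2

lemma measurable_renewalTime
    (h : IsAlternatingSequence P α Ξ d a χ) (n : ℕ) :
    Measurable (renewalTime d a n) := by
  unfold renewalTime
  have := h.measurable_d
  have := h.measurable_a
  fun_prop

lemma measurable_activeStart
    (h : IsAlternatingSequence P α Ξ d a χ) (n : ℕ) :
    Measurable (activeStart d a n) :=
  (h.measurable_renewalTime n).add (h.measurable_d n)

lemma measurable_prod_weight
    (h : IsAlternatingSequence P α Ξ d a χ) {w : X → ℝ≥0∞} (hw : Measurable w)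
    (n : ℕ) : Measurable fun ω => ∏ k ∈ Finset.range n, w (χ k ω) :=
  Finset.measurable_fun_prod _ fun k _ => hw.comp (h.measurable_χ k)

/-- The first `n` cycles are independent of the next one. -/
lemma indepFun_past_cycle [IsProbabilityMeasure P] 
    (h : IsAlternatingSequence P α Ξ d a χ) {w : X → ℝ≥0∞} (hw : Measurable w)
    (n : ℕ) :
    IndepFun (fun ω => (∏ k ∈ Finset.range n, w (χ k ω), renewalTime d a n ω))
      (cycle d a χ n) P := by
  have h1 := h.iIndepFun_cycle.indepFun_finset (Finset.range n) {n} (by simp) h.measurable_cycle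
  have hG : Measurable fun x : (i : Finset.range n) → ℝ × ℝ × X =>
      (∏ k : Finset.range n, w (x k).2.2, ∑ k : Finset.range n, ((x k).1 + (x k).2.1)) := by
    refine Measurable.prodMk (Finset.measurable_fun_prod _ fun k _ => hw.comp (by fun_prop)) (by fun_prop)
  have h2 := h1.comp hG (measurable_pi_apply (⟨n, Finset.mem_singleton_self n⟩ : ({n} : Finset ℕ)))
  convert h2 using 1
  · ext ω : 1
    simp only [Function.comp, renewalTime, cycle]
    rw [Finset.prod_coe_sort (Finset.range n) fun k => w (χ k ω),
      Finset.sum_coe_sort (Finset.range n) fun k => d k ω + a k ω]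
  · rfl

end IsAlternatingSequence

end Independence

/-! ### The law of one weighted cycle. -/

section Law

variable {X : Type*} [MeasurableSpace X] {α : ℝ} {Ξ : Measure (ℝ × X)} {w : X → ℝ≥0∞}

/-- The law of the length of an active period, weighted by a function of its state. -/
def activeMeasure (Ξ : Measure (ℝ × X)) (w : X → ℝ≥0∞) : Measure ℝ :=
  (Ξ.withDensity fun p => w p.2).map Prod.fst

instance [SFinite Ξ] : SFinite (activeMeasure Ξ w) := by
  unfold activeMeasure; infer_instance

lemma ae_pos_activeMeasure (hpos : ∀ᵐ p ∂Ξ, 0 < p.1) : ∀ᵐ a ∂activeMeasure Ξ w, 0 < a := by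
  rw [activeMeasure, ae_map_iff measurable_fst.aemeasurable measurableSet_Ioi]
  exact (withDensity_absolutelyContinuous _ _).ae_le hpos

lemma lintegral_activeMeasure (hw : Measurable w) {F : ℝ → ℝ≥0∞} (hF : Measurable F) :
    ∫⁻ a, F a ∂activeMeasure Ξ w = ∫⁻ p, w p.2 * F p.1 ∂Ξ := by
  rw [activeMeasure, lintegral_map hF measurable_fst,
    lintegral_withDensity_eq_lintegral_mul _ (by fun_prop) (by fun_prop)]
  rfl

lemma lintegral_expMeasure {F : ℝ → ℝ≥0∞} (hF : Measurable F) :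
    ∫⁻ y, F y ∂expMeasure α = ∫⁻ y, exponentialPDF α y * F y := by
  change ∫⁻ y, F y ∂volume.withDensity (exponentialPDF α) = _
  rw [lintegral_withDensity_eq_lintegral_mul _ (measurable_exponentialPDF α) hF]
  rfl

lemma lintegral_cycle_weight [SFinite Ξ] (hw : Measurable w) {F : ℝ → ℝ≥0∞} (hF : Measurable F)
    (s : ℝ) :
    ∫⁻ z, w z.2.2 * F (s - (z.1 + z.2.1)) ∂((expMeasure α).prod Ξ) =
      cycleStep α (activeMeasure Ξ w) F s := by
  rw [lintegral_prod _ (by fun_prop), lintegral_expMeasure (by fun_prop), cycleStep,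
    lconvolution_def]
  refine lintegral_congr fun y => ?_
  rw [shiftAverage, lintegral_activeMeasure hw (by fun_prop)]
  congr 1
  refine lintegral_congr fun p => ?_
  ring_nf

lemma expMeasure_Ioi (hα : 0 < α) {s : ℝ} (hs : 0 ≤ s) :
    expMeasure α (Set.Ioi s) = survival α s := by
  have := isProbabilityMeasure_expMeasure hα
  have h1 := survival_add_lintegral_exponentialPDF hα hs
  have h2 : expMeasure α (Set.Iic s) = ∫⁻ y in Set.Iic s, exponentialPDF α y := by
    rw [expMeasure, gammaMeasure, withDensity_apply _ measurableSet_Iic]; rfl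
  rw [← Set.compl_Iic, prob_compl_eq_one_sub measurableSet_Iic, ← h1, h2]
  refine ENNReal.add_sub_cancel_right (ne_top_of_le_ne_top ENNReal.one_ne_top ?_)
  rw [← h1]; exact le_add_self

lemma ae_nonneg_expMeasure : ∀ᵐ y ∂expMeasure α, 0 ≤ y := by
  rw [ae_iff, expMeasure, gammaMeasure, withDensity_apply _ (by measurability)]
  simp only [not_le]
  exact lintegral_exponentialPDF_of_nonpos le_rfl

end Law

/-! ### Ordering of the renewal times along a trajectory. -/

section Pathwise

variable {Ω : Type*} {d a : ℕ → Ω → ℝ}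

/-- The event that the system is dormant at time `t` after exactly `n` completed cycles. -/
def dormantPhase (d a : ℕ → Ω → ℝ) (t : ℝ) (n : ℕ) : Set Ω :=
  {ω | renewalTime d a n ω ≤ t ∧ t < activeStart d a n ω}

lemma dormantAt_eq_iUnion (t : ℝ) : dormantAt d a t = ⋃ n, dormantPhase d a t n := by
  ext ω; simp [dormantAt, dormantPhase]

lemma renewalTime_succ (n : ℕ) (ω : Ω) :
    renewalTime d a (n + 1) ω = activeStart d a n ω + a n ω := by
  rw [renewalTime, Finset.sum_range_succ, activeStart, renewalTime]; ring

lemma renewalTime_mono {ω : Ω} (hd : ∀ n, 0 ≤ d n ω) (ha : ∀ n, 0 < a n ω) :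
    Monotone fun n => renewalTime d a n ω :=
  monotone_nat_of_le_succ fun n => by
    rw [renewalTime_succ, activeStart]; linarith [hd n, ha n]

lemma activeStart_le_renewalTime {ω : Ω} (hd : ∀ n, 0 ≤ d n ω) (ha : ∀ n, 0 < a n ω) {m n : ℕ}
    (hmn : m < n) : activeStart d a m ω ≤ renewalTime d a n ω := by
  refine le_trans ?_ (renewalTime_mono hd ha hmn)
  change _ ≤ renewalTime d a (m + 1) ω
  rw [renewalTime_succ]; linarith [ha m]

end Pathwise

/-! ### The dormant mass as a weighted expectation. -/

section Trajectory

variable {Ω X : Type*} [MeasurableSpace Ω] [MeasurableSpace X]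
  {P : Measure Ω} {α : ℝ} {Ξ : Measure (ℝ × X)}
  {d a : ℕ → Ω → ℝ} {χ : ℕ → Ω → X}

namespace IsAlternatingSequence

lemma measurableSet_dormantPhase (h : IsAlternatingSequence P α Ξ d a χ) (t : ℝ) (n : ℕ) :
    MeasurableSet (dormantPhase d a t n) :=
  (measurableSet_le (h.measurable_renewalTime n) measurable_const).inter
    (measurableSet_lt measurable_const (h.measurable_activeStart n))

lemma ae_nonneg_pos (h : IsAlternatingSequence P α Ξ d a χ) (hpos : ∀ᵐ p ∂Ξ, 0 < p.1) :
    ∀ᵐ ω ∂P, (∀ n, 0 ≤ d n ω) ∧ ∀ n, 0 < a n ω := by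
  have h1 : ∀ n, ∀ᵐ ω ∂P, 0 ≤ d n ω := fun n =>
    ae_of_ae_map (h.measurable_d n).aemeasurable (by rw [h.law_d]; exact ae_nonneg_expMeasure)
  have h2 : ∀ n, ∀ᵐ ω ∂P, 0 < a n ω := fun n =>
    ae_of_ae_map (f := fun ω => (a n ω, χ n ω)) (p := fun p => 0 < p.1)
      ((h.measurable_a n).prodMk (h.measurable_χ n)).aemeasurable (by rw [h.law_aχ]; exact hpos)
  filter_upwards [ae_all_iff.2 h1, ae_all_iff.2 h2] with ω h1 h2 using ⟨h1, h2⟩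

variable {w : X → ℝ≥0∞}

/-- The last cycle is independent of the earlier ones; integrating it out replaces `F` by
`cycleStep` of `F`. The induction therefore runs over all `F`. -/
lemma lintegral_prod_weight_mul [IsProbabilityMeasure P] [SFinite Ξ]
    (h : IsAlternatingSequence P α Ξ d a χ) (hw : Measurable w) (n : ℕ) {F : ℝ → ℝ≥0∞}
    (hF : Measurable F) (t : ℝ) :
    ∫⁻ ω, (∏ k ∈ Finset.range n, w (χ k ω)) * F (t - renewalTime d a n ω) ∂P =
      (cycleStep α (activeMeasure Ξ w))^[n] F t := by
  induction n generalizing F with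
  | zero => simp [renewalTime]
  | succ n ih =>
    have hpast : Measurable fun ω => (∏ k ∈ Finset.range n, w (χ k ω), renewalTime d a n ω) :=
      (h.measurable_prod_weight hw n).prodMk (h.measurable_renewalTime n)
    have key := lintegral_comp_of_indepFun hpast (h.measurable_cycle n)
      (h.indepFun_past_cycle hw n)
      (U := fun x z => x.1 * (w z.2.2 * F (t - x.2 - (z.1 + z.2.1)))) (by
        simp only [Function.uncurry_def]; fun_prop)
    have hF' : Measurable (cycleStep α (activeMeasure Ξ w) F) := measurable_cycleStep hF
    rw [Function.iterate_succ_apply, ← ih hF']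
    calc _ = _ := by
          refine lintegral_congr fun ω => ?_
          rw [Finset.prod_range_succ, renewalTime_succ, activeStart, cycle, mul_assoc]
          ring_nf
      _ = _ := key
      _ = _ := by
          refine lintegral_congr fun ω => ?_
          rw [lintegral_const_mul _ (by fun_prop), h.map_cycle, lintegral_cycle_weight hw hF]

/-- Given the first `n` cycles, the next dormant period outlasts the remaining time `t - renewalTime
d a n` with probability `survival`, which is also `0` when that time is negative. -/
lemma lintegral_dormantPhase [IsProbabilityMeasure P] [SFinite Ξ]
    (h : IsAlternatingSequence P α Ξ d a χ) (hα : 0 < α) (hw : Measurable w) (t : ℝ) (n : ℕ) :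
    ∫⁻ ω in dormantPhase d a t n, ∏ k ∈ Finset.range n, w (χ k ω) ∂P =
      dormantTerm α (activeMeasure Ξ w) n t := by
  have hpast : Measurable fun ω => (∏ k ∈ Finset.range n, w (χ k ω), renewalTime d a n ω) :=
    (h.measurable_prod_weight hw n).prodMk (h.measurable_renewalTime n)
  have hS : MeasurableSet {q : ℝ × ℝ | 0 ≤ q.1 ∧ q.1 < q.2} :=
    (measurableSet_le measurable_const measurable_fst).inter
      (measurableSet_lt measurable_fst measurable_snd)
  have hind : Measurable ({q : ℝ × ℝ | 0 ≤ q.1 ∧ q.1 < q.2}.indicator (1 : ℝ × ℝ → ℝ≥0∞)) :=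
    measurable_one.indicator hS
  have key := lintegral_comp_of_indepFun hpast (h.measurable_d n)
    ((h.indepFun_past_cycle hw n).comp measurable_id measurable_fst)
    (U := fun x y => x.1 * {q : ℝ × ℝ | 0 ≤ q.1 ∧ q.1 < q.2}.indicator (1 : ℝ × ℝ → ℝ≥0∞)
      (t - x.2, y)) (by
        simp only [Function.uncurry_def]
        exact Measurable.mul (by fun_prop) (hind.comp (by fun_prop)))
  rw [dormantTerm, ← h.lintegral_prod_weight_mul hw n (measurable_survival α),
    ← lintegral_indicator (h.measurableSet_dormantPhase t n)]
  refine Eq.trans (lintegral_congr fun ω => ?_) (key.trans (lintegral_congr fun ω => ?_))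
  · have hiff : ω ∈ dormantPhase d a t n ↔ (t - renewalTime d a n ω, d n ω) ∈
        {q : ℝ × ℝ | 0 ≤ q.1 ∧ q.1 < q.2} := by
      simp [dormantPhase, activeStart, sub_lt_iff_lt_add']
    by_cases hω : ω ∈ dormantPhase d a t n
    · rw [Set.indicator_of_mem hω, Set.indicator_of_mem (hiff.1 hω), Pi.one_apply, mul_one]
    · rw [Set.indicator_of_notMem hω, Set.indicator_of_notMem (fun h => hω (hiff.2 h)), mul_zero]
  · refine (lintegral_const_mul _ (hind.comp measurable_prodMk_left)).trans ?_
    rw [h.law_d]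
    congr 1
    rcases lt_or_ge (t - renewalTime d a n ω) 0 with hts | hts
    · rw [survival_of_neg hts]
      simp [not_le.2 hts]
    · rw [← expMeasure_Ioi hα hts, ← lintegral_indicator_one measurableSet_Ioi]
      refine lintegral_congr fun y => ?_
      simp [Set.indicator_apply, hts]

/-- The dormant mass as an expectation: the states of the completed cycles are weighted by `w`. -/
lemma setLIntegral_dormantAt [IsProbabilityMeasure P] [SFinite Ξ]
    (h : IsAlternatingSequence P α Ξ d a χ) (hα : 0 < α) (hpos : ∀ᵐ p ∂Ξ, 0 < p.1)
    (hw : Measurable w) (t : ℝ) {V : Ω → ℝ≥0∞}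
    (hV : ∀ᵐ ω ∂P, ∀ n, ω ∈ dormantPhase d a t n → V ω = ∏ k ∈ Finset.range n, w (χ k ω)) :
    ∫⁻ ω in dormantAt d a t, V ω ∂P = dormantMass α (activeMeasure Ξ w) t := by
  rw [dormantAt_eq_iUnion, lintegral_iUnion₀
    (fun n => (h.measurableSet_dormantPhase t n).nullMeasurableSet), dormantMass]
  · refine tsum_congr fun n => ?_
    rw [← h.lintegral_dormantPhase hα hw]
    refine setLIntegral_congr_fun_ae (h.measurableSet_dormantPhase t n) ?_
    filter_upwards [hV] with ω hω using hω n
  · have hlt : ∀ m n, m < n → AEDisjoint P (dormantPhase d a t m) (dormantPhase d a t n) := by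
      intro m n hmn
      rw [AEDisjoint, measure_eq_zero_iff_ae_notMem]
      filter_upwards [h.ae_nonneg_pos hpos] with ω hω
      rintro ⟨h1, h2⟩
      exact absurd (h1.2.trans_le (activeStart_le_renewalTime hω.1 hω.2 hmn)) (not_lt.2 h2.1)
    intro m n hmn
    rcases lt_or_gt_of_ne hmn with hmn | hmn
    · exact hlt m n hmn
    · exact (hlt n m hmn).symm

lemma measure_dormantAt [IsProbabilityMeasure P] [SFinite Ξ]
    (h : IsAlternatingSequence P α Ξ d a χ) (hα : 0 < α) (hpos : ∀ᵐ p ∂Ξ, 0 < p.1) (t : ℝ) :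
    P (dormantAt d a t) = dormantMass α (activeMeasure Ξ 1) t := by
  rw [← h.setLIntegral_dormantAt hα hpos measurable_one t (V := 1) (ae_of_all _ fun ω n _ => by simp)]
  simp

end IsAlternatingSequence

end Trajectory

/-! ### Boltzmann factors of finite configurations. -/

section Hamiltonian

variable {X : Type*} [MeasurableSpace X] {E : X → EReal}

lemma measurable_hamiltonian (hE : Measurable E) : Measurable (hamiltonian E) := by
  have h1 : Measurable fun ζ : Measure (ℝ × ℝ × X) => ∫⁻ p, (E p.2.2).toENNReal ∂ζ :=
    Measure.measurable_lintegral (by fun_prop)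
  have h2 : Measurable fun ζ : Measure (ℝ × ℝ × X) => ∫⁻ p, (-E p.2.2).toENNReal ∂ζ :=
    Measure.measurable_lintegral
      ((continuous_neg.measurable.comp (hE.comp (by fun_prop))).ereal_toENNReal)
  unfold hamiltonian
  exact h1.coe_ereal_ennreal.add (continuous_neg.measurable.comp h2.coe_ereal_ennreal)

lemma measurable_exp_neg_hamiltonian (hE : Measurable E) :
    Measurable fun ζ : Measure (ℝ × ℝ × X) => EReal.exp (-hamiltonian E ζ) :=
  EReal.measurable_exp.comp (continuous_neg.measurable.comp (measurable_hamiltonian hE))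

/-- At most one of the two parts is nonzero. The split mirrors the two integrals in `hamiltonian`,
each of which exponentiates to a product on its own. -/
lemma exp_neg_eq (e : EReal) : EReal.exp (-e) =
    (EReal.exp (e.toENNReal : EReal))⁻¹ * EReal.exp ((-e).toENNReal : EReal) := by
  rcases le_total 0 e with h | h
  · rw [EReal.coe_toENNReal h, EReal.toENNReal_of_nonpos (by simpa using h)]
    simp [EReal.exp_neg]
  · rw [EReal.toENNReal_of_nonpos h, EReal.coe_toENNReal (by simpa using h)]
    simp

lemma exp_sum {ι : Type*} (s : Finset ι) (f : ι → ℝ≥0∞) :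
    EReal.exp ((∑ i ∈ s, f i : ℝ≥0∞) : EReal) = ∏ i ∈ s, EReal.exp (f i : EReal) := by
  classical
  induction s using Finset.induction_on with
  | empty => simp
  | insert i s hi ih =>
    rw [Finset.sum_insert hi, Finset.prod_insert hi, EReal.coe_ennreal_add, EReal.exp_add, ih]

lemma exp_coe_ennreal_ne_zero (x : ℝ≥0∞) : EReal.exp (x : EReal) ≠ 0 := by
  simp

/-- The Boltzmann factor of a finite configuration is the product of those of its points. -/
lemma exp_neg_hamiltonian {ζ : Measure (ℝ × ℝ × X)} (hEtop : ∀ x, E x ≠ ⊤) {ι : Type*}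
    (s : Finset ι) (x : ι → X)
    (hζ : ∀ f : X → ℝ≥0∞, Measurable f → ∫⁻ p, f p.2.2 ∂ζ = ∑ i ∈ s, f (x i)) (hE : Measurable E) :
    EReal.exp (-hamiltonian E ζ) = ∏ i ∈ s, EReal.exp (-E (x i)) := by
  rw [hamiltonian, hζ (fun x => (E x).toENNReal) hE.ereal_toENNReal,
    hζ (fun x => (-E x).toENNReal) (continuous_neg.measurable.comp hE).ereal_toENNReal,
    EReal.exp_neg, sub_eq_add_neg, EReal.exp_add, EReal.exp_neg]
  -- `E < ∞` makes the positive part of the energy finite, which rules out `∞ - ∞`.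
  have hfin : EReal.exp ((∑ i ∈ s, (E (x i)).toENNReal : ℝ≥0∞) : EReal) ≠ ∞ := by
    rw [Ne, EReal.exp_eq_top_iff, EReal.coe_ennreal_eq_top_iff]
    exact ENNReal.sum_ne_top.2 fun i _ => by simpa using hEtop (x i)
  rw [ENNReal.mul_inv (Or.inl (exp_coe_ennreal_ne_zero _)) (Or.inl hfin), inv_inv, exp_sum, exp_sum,
    ENNReal.prod_inv_distrib]
  · rw [← Finset.prod_mul_distrib]
    exact Finset.prod_congr rfl fun i _ => (exp_neg_eq _).symm
  · intro i _ j _ _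
    exact Or.inl (exp_coe_ennreal_ne_zero _)

lemma measurableSet_meeting (b c : ℝ) : MeasurableSet (meeting X b c) := by
  have : meeting X b c = {p | p.1 < p.2.1} ∩ {p | max p.1 b ≤ min p.2.1 c} := by
    ext p
    simp [meeting, Set.Icc_inter_Icc, Set.nonempty_Icc]
  rw [this]
  exact (measurableSet_lt (by fun_prop) (by fun_prop)).inter
    (measurableSet_le (by fun_prop) (by fun_prop))

end Hamiltonian

/-! ### The configuration seen in the observation window. -/

section Pathwise

variable {Ω X : Type*} {d a : ℕ → Ω → ℝ} {χ : ℕ → Ω → X} {E : X → EReal}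

lemma tiltWeight_eq (lam : ℝ) (ω : Ω) : tiltWeight d a χ E lam ω = EReal.exp (-E (χ 0 ω)) *
    (ENNReal.ofReal (Real.exp (-(lam * d 0 ω))) * ENNReal.ofReal (Real.exp (-(lam * a 0 ω)))) := by
  rw [tiltWeight, sub_eq_add_neg, EReal.exp_add, EReal.exp_coe, mul_comm,
    ← ENNReal.ofReal_mul (Real.exp_pos _).le, ← Real.exp_add, firstCycle]
  ring_nf

variable [MeasurableSpace X]

lemma lintegral_restrictTo_translate_eta (t : ℝ) (ω : Ω) {f : X → ℝ≥0∞} (hf : Measurable f) :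
    ∫⁻ p, f p.2.2 ∂(restrictTo (-t) t (translate t (eta d a χ ω))) =
      ∑' n, (meeting X (-t) t).indicator (fun p => f p.2.2)
        (activeStart d a n ω - t, renewalTime d a (n + 1) ω - t, χ n ω) := by
  have hF : Measurable ((meeting X (-t) t).indicator fun p : ℝ × ℝ × X => f p.2.2) :=
    (show Measurable fun p : ℝ × ℝ × X => f p.2.2 by fun_prop).indicator (measurableSet_meeting _ _)
  rw [restrictTo, ← lintegral_indicator (measurableSet_meeting _ _), translate,
    lintegral_map hF (by fun_prop), eta, lintegral_sum_measure]
  refine tsum_congr fun n => ?_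
  exact lintegral_dirac' _ (hF.comp (by fun_prop))

/-- On the event that exactly `n` cycles are completed at the dormant time `2t`, the active periods
of these cycles are the ones that meet the observation window. -/
lemma lintegral_configuration {t : ℝ} {ω : Ω} (hd : ∀ n, 0 ≤ d n ω) (ha : ∀ n, 0 < a n ω) {n : ℕ}
    (hn : ω ∈ dormantPhase d a (2 * t) n) {f : X → ℝ≥0∞} (hf : Measurable f) :
    ∫⁻ p, f p.2.2 ∂(restrictTo (-t) t (translate t (eta d a χ ω))) =
      ∑ k ∈ Finset.range n, f (χ k ω) := by
  rw [lintegral_restrictTo_translate_eta t ω hf, tsum_eq_sum (s := Finset.range n)]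
  · refine Finset.sum_congr rfl fun k hk => ?_
    rw [Finset.mem_range] at hk
    refine Set.indicator_of_mem (s := meeting X (-t) t) ⟨?_, ?_⟩ _
    · simp only [renewalTime_succ]; linarith [ha k]
    · have h0 : 0 ≤ renewalTime d a k ω := by
        simpa [renewalTime] using renewalTime_mono hd ha (Nat.zero_le k)
      have h1 : activeStart d a k ω ≤ 2 * t := (activeStart_le_renewalTime hd ha hk).trans hn.1
      have h2 : 0 ≤ activeStart d a k ω := add_nonneg h0 (hd k)
      refine ⟨activeStart d a k ω - t, ⟨le_rfl, ?_⟩, ?_, ?_⟩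
      · simp only [renewalTime_succ]; linarith [ha k]
      · linarith
      · linarith
  -- Active periods number `n + 1` and later start strictly after `2t`, so they miss even the closed
  -- window.
  · intro k hk
    rw [Finset.mem_range, not_lt] at hk
    refine Set.indicator_of_notMem (s := meeting X (-t) t) ?_ _
    rintro ⟨-, y, ⟨h1, -⟩, -, h2⟩
    have h3 : activeStart d a n ω ≤ activeStart d a k ω := by
      rcases hk.eq_or_lt with rfl | hk
      · exact le_rfl
      · exact (activeStart_le_renewalTime hd ha hk).trans (le_add_of_nonneg_right (hd k))
    have h4 := hn.2
    simp only at h1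
    linarith

end Pathwise

/-! ### The partition function, and moments of the tilted cycle. -/

section Configuration

variable {Ω X : Type*} [MeasurableSpace Ω] [MeasurableSpace X]
  {P : Measure Ω} {α : ℝ} {Ξ : Measure (ℝ × X)}
  {d a : ℕ → Ω → ℝ} {χ : ℕ → Ω → X} {E : X → EReal}

namespace IsAlternatingSequence

lemma measurable_configuration (h : IsAlternatingSequence P α Ξ d a χ) (t : ℝ) :
    Measurable fun ω => restrictTo (-t) t (translate t (eta d a χ ω)) := by
  refine Measure.measurable_of_measurable_coe _ fun s hs => ?_
  have hs' := hs.inter (measurableSet_meeting (X := X) (-t) t)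
  have hτ : Measurable fun p : ℝ × ℝ × X => (p.1 - t, p.2.1 - t, p.2.2) := by fun_prop
  simp only [restrictTo, translate, eta, Measure.restrict_apply hs, Measure.map_apply hτ hs',
    Measure.sum_apply _ (hτ hs'), Measure.dirac_apply' _ (hτ hs')]
  refine Measurable.tsum fun n => ?_
  exact (measurable_one.indicator (hτ hs')).comp ((h.measurable_activeStart n).prodMk
    ((h.measurable_renewalTime (n + 1)).prodMk (h.measurable_χ n)))

/-- Under dormancy at the end of the window, the configuration consists exactly of the completed
cycles, so its Boltzmann factor is the product of their weights; conditioning supplies the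
denominator. -/
lemma partitionFunction_eq [IsProbabilityMeasure P] [SFinite Ξ]
    (h : IsAlternatingSequence P α Ξ d a χ) (hα : 0 < α) (hpos : ∀ᵐ p ∂Ξ, 0 < p.1)
    (hE : Measurable E) (hEtop : ∀ x, E x ≠ ⊤) (t : ℝ) :
    partitionFunction P d a χ E t = (dormantMass α (activeMeasure Ξ 1) t)⁻¹ *
      dormantMass α (activeMeasure Ξ fun x => EReal.exp (-E x)) t := by
  have hw : Measurable fun x => EReal.exp (-E x) :=
    EReal.measurable_exp.comp (continuous_neg.measurable.comp hE)
  -- `partitionFunction` at `t` uses half-width `t / 2`, so dormancy is imposed at time `t`.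
  have h2t : 2 * (t / 2) = t := by ring
  rw [partitionFunction, referenceLaw, lintegral_map (measurable_exp_neg_hamiltonian hE)
    (h.measurable_configuration _), ProbabilityTheory.cond, lintegral_smul_measure, h2t,
    h.measure_dormantAt hα hpos, smul_eq_mul]
  congr 1
  refine h.setLIntegral_dormantAt hα hpos hw t ?_
  filter_upwards [h.ae_nonneg_pos hpos] with ω hω n hn
  refine exp_neg_hamiltonian hEtop _ _ (fun f hf => ?_) hE
  rw [← h2t] at hn
  exact lintegral_configuration hω.1 hω.2 hn hf

lemma lintegral_weight_mul_mul [IsProbabilityMeasure P] [SFinite Ξ]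
    (h : IsAlternatingSequence P α Ξ d a χ) {w : X → ℝ≥0∞} (hw : Measurable w) {u v : ℝ → ℝ≥0∞}
    (hu : Measurable u) (hv : Measurable v) :
    ∫⁻ ω, w (χ 0 ω) * (u (d 0 ω) * v (a 0 ω)) ∂P =
      (∫⁻ y, exponentialPDF α y * u y) * ∫⁻ s, v s ∂activeMeasure Ξ w := by
  calc _ = ∫⁻ z, w z.2.2 * (u z.1 * v z.2.1) ∂(P.map (cycle d a χ 0)) :=
        (lintegral_map (by fun_prop) (h.measurable_cycle 0)).symm
    _ = ∫⁻ y, u y * (∫⁻ s, v s ∂activeMeasure Ξ w) ∂expMeasure α := by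
        rw [h.map_cycle, lintegral_prod _ (by fun_prop)]
        refine lintegral_congr fun y => ?_
        rw [lintegral_activeMeasure hw hv, ← lintegral_const_mul _ (by fun_prop)]
        exact lintegral_congr fun p => mul_left_comm _ _ _
    _ = _ := by
        rw [lintegral_mul_const _ hu, lintegral_expMeasure hu]

end IsAlternatingSequence

lemma lintegral_exponentialPDF_mul_exp (hα : 0 < α) {lam : ℝ} (hl : 0 < α + lam) :
    ∫⁻ y, exponentialPDF α y * ENNReal.ofReal (Real.exp (-(lam * y))) =
      ENNReal.ofReal (α / (α + lam)) := by
  have : ∀ y, exponentialPDF α y * ENNReal.ofReal (Real.exp (-(lam * y))) =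
      ENNReal.ofReal (α / (α + lam)) * exponentialPDF (α + lam) y := fun y => by
    rcases lt_or_ge y 0 with hy | hy
    · simp [exponentialPDF_of_neg hy]
    · rw [exponentialPDF_of_nonneg hy, exponentialPDF_of_nonneg hy,
        ← ENNReal.ofReal_mul (by positivity), ← ENNReal.ofReal_mul (by positivity), mul_assoc,
        ← Real.exp_add, ← mul_assoc, div_mul_cancel₀ _ hl.ne']
      ring_nf
  simp only [this]
  rw [lintegral_const_mul _ (measurable_exponentialPDF _), lintegral_exponentialPDF_eq_one hl,
    mul_one]

lemma lintegral_tiltedMeasure {ρ : Measure ℝ} (hα : 0 < α) {lam : ℝ} (hl : 0 < α + lam)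
    {F : ℝ → ℝ≥0∞} (hF : Measurable F) : ∫⁻ s, F s ∂tiltedMeasure α ρ lam =
      ENNReal.ofReal (α / (α + lam)) * ∫⁻ s, ENNReal.ofReal (Real.exp (-(lam * s))) * F s ∂ρ := by
  rw [tiltedMeasure, lintegral_withDensity_eq_lintegral_mul _ (by fun_prop) hF,
    ← lintegral_const_mul _ (by fun_prop)]
  refine lintegral_congr fun s => ?_
  rw [Pi.mul_apply, ENNReal.ofReal_mul (by positivity), mul_assoc]

namespace IsAlternatingSequence

/-- The dormant period contributes its Laplace transform `α / (α + lam)`, the constant built into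
`tiltedMeasure`. -/
lemma lintegral_tiltWeight [IsProbabilityMeasure P] [SFinite Ξ]
    (h : IsAlternatingSequence P α Ξ d a χ) (hα : 0 < α) (hE : Measurable E) {lam : ℝ}
    (hl : 0 < α + lam) : ∫⁻ ω, tiltWeight d a χ E lam ω ∂P =
      tiltedMeasure α (activeMeasure Ξ fun x => EReal.exp (-E x)) lam Set.univ := by
  have hw : Measurable fun x => EReal.exp (-E x) :=
    EReal.measurable_exp.comp (continuous_neg.measurable.comp hE)
  simp only [tiltWeight_eq]
  rw [h.lintegral_weight_mul_mul (u := fun y => ENNReal.ofReal (Real.exp (-(lam * y))))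
    (v := fun y => ENNReal.ofReal (Real.exp (-(lam * y)))) hw (by fun_prop) (by fun_prop),
    lintegral_exponentialPDF_mul_exp hα hl, ← lintegral_one,
    lintegral_tiltedMeasure hα hl measurable_const]
  simp

/-- The Laplace transform of the dormant period diverges, and the factor from the active period is
positive because `E < ∞`. Thus every admissible `lam` satisfies `α + lam > 0`. -/
lemma lintegral_tiltWeight_eq_top [IsProbabilityMeasure P] [IsProbabilityMeasure Ξ]
    (h : IsAlternatingSequence P α Ξ d a χ) (hα : 0 < α) (hE : Measurable E)
    (hEtop : ∀ x, E x ≠ ⊤) {lam : ℝ} (hl : α + lam ≤ 0) :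
    ∫⁻ ω, tiltWeight d a χ E lam ω ∂P = ∞ := by
  have hw : Measurable fun x => EReal.exp (-E x) :=
    EReal.measurable_exp.comp (continuous_neg.measurable.comp hE)
  simp only [tiltWeight_eq]
  rw [h.lintegral_weight_mul_mul (u := fun y => ENNReal.ofReal (Real.exp (-(lam * y))))
    (v := fun y => ENNReal.ofReal (Real.exp (-(lam * y)))) hw (by fun_prop) (by fun_prop)]
  have h1 : ∫⁻ y, exponentialPDF α y * ENNReal.ofReal (Real.exp (-(lam * y))) = ∞ := by
    rw [← top_le_iff]
    calc ∞ = ∫⁻ y, (Set.Ici (0 : ℝ)).indicator (fun _ => ENNReal.ofReal α) y := by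
          rw [lintegral_indicator measurableSet_Ici, setLIntegral_const, Real.volume_Ici,
            ENNReal.mul_top (by simpa using hα)]
      _ ≤ _ := by
          refine lintegral_mono fun y => ?_
          rw [Set.indicator_apply]
          split_ifs with hy
          · rw [exponentialPDF_of_nonneg hy, ← ENNReal.ofReal_mul (by positivity), mul_assoc,
              ← Real.exp_add]
            refine ENNReal.ofReal_le_ofReal (le_mul_of_one_le_right hα.le (Real.one_le_exp ?_))
            have : 0 ≤ y := hy
            nlinarith
          · exact zero_le
  rw [h1, ENNReal.top_mul]
  rw [lintegral_activeMeasure hw (by fun_prop), Ne, lintegral_eq_zero_iff (by fun_prop)]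
  intro h0
  have hne : ∀ p : ℝ × X, EReal.exp (-E p.2) * ENNReal.ofReal (Real.exp (-(lam * p.1))) ≠ 0 :=
    fun p => mul_ne_zero (by simpa using hEtop p.2) (by simpa using Real.exp_pos _)
  obtain ⟨p, hp⟩ := h0.exists
  exact hne p hp

/-- Fatou's lemma along `φ + 1/(n+1)`; it makes the infimum in the variational formula attained. -/
lemma lintegral_tiltWeight_le_of_forall_gt (h : IsAlternatingSequence P α Ξ d a χ)
    (hE : Measurable E) {φ : ℝ} {c : ℝ≥0∞}
    (hc : ∀ lam, φ < lam → ∫⁻ ω, tiltWeight d a χ E lam ω ∂P ≤ c) :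
    ∫⁻ ω, tiltWeight d a χ E φ ω ∂P ≤ c := by
  have hlim : Tendsto (fun n : ℕ => φ + 1 / ((n : ℝ) + 1)) atTop (𝓝 φ) := by
    simpa using tendsto_const_nhds.add (tendsto_one_div_add_atTop_nhds_zero_nat (𝕜 := ℝ))
  have hm : ∀ lam, Measurable (tiltWeight d a χ E lam) := fun lam => by
    have hw : Measurable fun ω => EReal.exp (-E (χ 0 ω)) :=
      EReal.measurable_exp.comp (continuous_neg.measurable.comp (hE.comp (h.measurable_χ 0)))
    have := h.measurable_d 0
    have := h.measurable_a 0
    rw [funext (tiltWeight_eq lam)]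
    exact hw.mul (by fun_prop)
  have htend : ∀ ω, Tendsto (fun n : ℕ => tiltWeight d a χ E (φ + 1 / ((n : ℝ) + 1)) ω) atTop
      (𝓝 (tiltWeight d a χ E φ ω)) := fun ω => by
    simp only [tiltWeight_eq, ← ENNReal.ofReal_mul (Real.exp_pos _).le]
    refine ENNReal.Tendsto.const_mul ((ENNReal.continuous_ofReal.tendsto _).comp ?_)
      (Or.inl (by simpa using mul_pos (Real.exp_pos _) (Real.exp_pos _)))
    have hcont : Continuous fun lam : ℝ => Real.exp (-(lam * d 0 ω)) * Real.exp (-(lam * a 0 ω)) := by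
      fun_prop
    exact (hcont.tendsto φ).comp hlim
  calc ∫⁻ ω, tiltWeight d a χ E φ ω ∂P
      = ∫⁻ ω, liminf (fun n : ℕ => tiltWeight d a χ E (φ + 1 / ((n : ℝ) + 1)) ω) atTop ∂P :=
        lintegral_congr fun ω => (htend ω).liminf_eq.symm
    _ ≤ liminf (fun n : ℕ => ∫⁻ ω, tiltWeight d a χ E (φ + 1 / ((n : ℝ) + 1)) ω ∂P) atTop :=
        lintegral_liminf_le fun n => hm _
    _ ≤ c := liminf_le_of_frequently_le'
        (Frequently.of_forall fun n => hc _ (lt_add_of_pos_right φ (by positivity)))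

/-- Bound `T₁` by its two summands: the active one yields the mean of the tilted measure, and the
dormant one is integrable because the tilted exponential rate `α + lam` is positive. -/
lemma lintegral_firstCycle_mul_tiltWeight_lt_top [IsProbabilityMeasure P] [SFinite Ξ]
    (h : IsAlternatingSequence P α Ξ d a χ) (hα : 0 < α) (hE : Measurable E) {lam : ℝ}
    (hl : 0 < α + lam)
    (hm : tiltedMeasure α (activeMeasure Ξ fun x => EReal.exp (-E x)) lam Set.univ ≠ ∞)
    (hmean : ∫⁻ s, ENNReal.ofReal s
      ∂tiltedMeasure α (activeMeasure Ξ fun x => EReal.exp (-E x)) lam ≠ ∞) :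
    ∫⁻ ω, ENNReal.ofReal (firstCycle d a ω) * tiltWeight d a χ E lam ω ∂P < ∞ := by
  have hw : Measurable fun x => EReal.exp (-E x) :=
    EReal.measurable_exp.comp (continuous_neg.measurable.comp hE)
  set ρ := activeMeasure Ξ fun x => EReal.exp (-E x)
  set e : ℝ → ℝ≥0∞ := fun y => ENNReal.ofReal (Real.exp (-(lam * y))) with he
  have hem : Measurable e := by fun_prop
  have hc : ENNReal.ofReal (α / (α + lam)) ≠ 0 := by simpa using div_pos hα hl
  rw [← lintegral_one, lintegral_tiltedMeasure hα hl measurable_const] at hm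
  rw [lintegral_tiltedMeasure hα hl ENNReal.measurable_ofReal] at hmean
  have hm' : ∫⁻ s, e s ∂ρ ≠ ∞ := by
    intro htop
    refine hm ?_
    simp only [mul_one]
    rw [show ∫⁻ s, ENNReal.ofReal (Real.exp (-(lam * s))) ∂ρ = ∞ from htop, ENNReal.mul_top hc]
  have hmean' : ∫⁻ s, e s * ENNReal.ofReal s ∂ρ ≠ ∞ := fun htop =>
    hmean (by rw [htop, ENNReal.mul_top hc])
  have h1 : ∫⁻ ω, EReal.exp (-E (χ 0 ω)) * (ENNReal.ofReal (d 0 ω) * e (d 0 ω) * e (a 0 ω)) ∂P ≠ ∞ := by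
    rw [h.lintegral_weight_mul_mul (u := fun y => ENNReal.ofReal y * e y) hw (by fun_prop) hem]
    refine ENNReal.mul_ne_top ?_ hm'
    -- Half of the exponential rate absorbs the linear factor `y`, the other half remains
    -- integrable.
    set c := (α + lam) / 2 with hcdef
    have hcpos : 0 < c := by positivity
    refine ne_top_of_le_ne_top (b := ∫⁻ y, ENNReal.ofReal (α / c) * survival c y) ?_
      (lintegral_mono fun y => ?_)
    · rw [lintegral_const_mul _ (by fun_prop), lintegral_survival hcpos]
      exact ENNReal.mul_ne_top ENNReal.ofReal_ne_top (by simpa using hcpos)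
    · rcases lt_or_ge y 0 with hy | hy
      · simp [exponentialPDF_of_neg hy]
      · rw [exponentialPDF_of_nonneg hy, survival_of_nonneg hy, he, ← ENNReal.ofReal_mul hy,
          ← ENNReal.ofReal_mul (by positivity), ← ENNReal.ofReal_mul (by positivity)]
        refine ENNReal.ofReal_le_ofReal ?_
        have h2 : c * y ≤ Real.exp (c * y) := by linarith [Real.add_one_le_exp (c * y)]
        have h3 : Real.exp (-(α * y)) * Real.exp (-(lam * y)) =
            Real.exp (-(c * y)) * Real.exp (-(c * y)) := by
          rw [← Real.exp_add, ← Real.exp_add, hcdef]; ring_nf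
        calc α * Real.exp (-(α * y)) * (y * Real.exp (-(lam * y)))
            = α / c * (c * y) * (Real.exp (-(α * y)) * Real.exp (-(lam * y))) := by field_simp
          _ ≤ α / c * Real.exp (c * y) * (Real.exp (-(α * y)) * Real.exp (-(lam * y))) := by gcongr
          _ = α / c * (Real.exp (c * y) * Real.exp (-(c * y))) * Real.exp (-(c * y)) := by
              rw [h3]; ring
          _ = _ := by rw [← Real.exp_add]; simp
  have h2 : ∫⁻ ω, EReal.exp (-E (χ 0 ω)) * (e (d 0 ω) * (e (a 0 ω) * ENNReal.ofReal (a 0 ω))) ∂P ≠ ∞ := by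
    rw [h.lintegral_weight_mul_mul (v := fun y => e y * ENNReal.ofReal y) hw hem (by fun_prop),
      lintegral_exponentialPDF_mul_exp hα hl]
    exact ENNReal.mul_ne_top ENNReal.ofReal_ne_top hmean'
  refine lt_of_le_of_lt ?_ (ENNReal.add_lt_top.2 ⟨h1.lt_top, h2.lt_top⟩)
  have hwχ := hw.comp (h.measurable_χ 0)
  have hdm := h.measurable_d 0
  have ham := h.measurable_a 0
  have hm1 : Measurable fun ω => EReal.exp (-E (χ 0 ω)) *
      (ENNReal.ofReal (d 0 ω) * e (d 0 ω) * e (a 0 ω)) := hwχ.mul (by fun_prop)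
  rw [← lintegral_add_left hm1]
  refine lintegral_mono fun ω => ?_
  rw [tiltWeight_eq, firstCycle]
  calc _ ≤ (ENNReal.ofReal (d 0 ω) + ENNReal.ofReal (a 0 ω)) *
        (EReal.exp (-E (χ 0 ω)) * (e (d 0 ω) * e (a 0 ω))) := by
        gcongr
        exact ENNReal.ofReal_add_le
    _ = _ := by ring

end IsAlternatingSequence

end Configuration

end AlternatingProcess

end

/-! ### The free energy and its variational formula. -/

theorem mainTheorem8
    {Ω X : Type*} [MeasurableSpace Ω]
    [TopologicalSpace X] [PolishSpace X] [MeasurableSpace X] [BorelSpace X]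
    (P : Measure Ω) [IsProbabilityMeasure P]
    (α : ℝ) (hα : 0 < α)
    (Ξ : Measure (ℝ × X)) [IsProbabilityMeasure Ξ]
    (hpos : ∀ᵐ p ∂Ξ, 0 < p.1) (hmean : Integrable (fun p : ℝ × X => p.1) Ξ)
    (d a : ℕ → Ω → ℝ) (χ : ℕ → Ω → X)
    (hseq : AlternatingProcess.IsAlternatingSequence P α Ξ d a χ)
    (E : X → EReal) (hE : Measurable E) (hEtop : ∀ x, E x ≠ ⊤) :
    Tendsto (fun t : ℝ =>
        ENNReal.log (AlternatingProcess.partitionFunction P d a χ E t) / (t : EReal))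
      atTop (𝓝 (AlternatingProcess.freeEnergy P d a χ E)) ∧
    AlternatingProcess.freeEnergy P d a χ E ≠ ⊥ ∧
    ∀ φ : ℝ, AlternatingProcess.freeEnergy P d a χ E = (φ : EReal) →
      IsLeast {lam : ℝ | ∫⁻ ω, AlternatingProcess.tiltWeight d a χ E lam ω ∂P ≤ 1} φ ∧
      (¬ AlternatingProcess.Goodness P d a χ E →
        Tendsto (fun t : ℝ =>
            AlternatingProcess.partitionFunction P d a χ E t
              * ENNReal.ofReal (Real.exp (-φ * t)))
          atTop (𝓝 0)) := by
  open AlternatingProcess in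
  have hw : Measurable fun x => EReal.exp (-E x) :=
    EReal.measurable_exp.comp (continuous_neg.measurable.comp hE)
  set ρ₀ := activeMeasure Ξ fun x => EReal.exp (-E x)
  set ρ₁ := activeMeasure Ξ 1 with hρ₁
  have hρ₀pos : ∀ᵐ s ∂ρ₀, 0 < s := ae_pos_activeMeasure hpos
  have hρ₁pos : ∀ᵐ s ∂ρ₁, 0 < s := ae_pos_activeMeasure hpos
  have hρ₁univ : ρ₁ Set.univ = 1 := by
    rw [← lintegral_one, lintegral_activeMeasure measurable_one measurable_const]; simp
  -- The finite mean of the active periods keeps the conditioning probability away from `0`, which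
  -- makes the partition function comparable to `dormantMass α ρ₀`.
  have hρ₁mean : ∫⁻ y, activeTail ρ₁ y ≠ ∞ := by
    rw [lintegral_activeTail hρ₁pos hρ₁univ, hρ₁,
      lintegral_activeMeasure measurable_one ENNReal.measurable_ofReal]
    simpa using hmean.lintegral_lt_top.ne
  obtain ⟨c, hc0, hc⟩ := exists_pos_le_dormantMass hα hρ₁pos hρ₁univ.le hρ₁mean
  have hZ : ∀ t, partitionFunction P d a χ E t = (dormantMass α ρ₁ t)⁻¹ * dormantMass α ρ₀ t :=
    hseq.partitionFunction_eq hα hpos hE hEtop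
  have hgZ : ∀ t, 0 < t → dormantMass α ρ₀ t ≤ partitionFunction P d a χ E t := fun t _ => by
    rw [hZ]
    exact le_mul_of_one_le_left' (ENNReal.one_le_inv.2 (dormantMass_le_one hα hρ₁pos hρ₁univ.le t))
  have hZg : ∀ t, 0 < t → partitionFunction P d a χ E t ≤ c⁻¹ * dormantMass α ρ₀ t := fun t ht => by
    rw [hZ]
    gcongr
    exact hc t ht.le
  obtain ⟨ψ, hψ, hψbot, hgψ, hψle⟩ := exists_tendsto_log_div (g := dormantMass α ρ₀) (α := α)
    (ENNReal.inv_ne_top.2 hc0) (fun s t hs ht => dormantMass_mul_le hα hρ₀pos hs ht)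
    (fun t ht => by rw [← survival_of_nonneg ht]; exact survival_le_dormantMass t) hgZ hZg
  have hfree : freeEnergy P d a χ E = ψ := hψ.limUnder_eq
  rw [hfree]
  refine ⟨hψ, hψbot, fun φ hφ => ?_⟩
  subst hφ
  have hbound : ∀ t, 0 < t → dormantMass α ρ₀ t ≤ ENNReal.ofReal (Real.exp (φ * t)) :=
    fun t ht => (log_div_le_iff ht φ).1 (hgψ t ht)
  have hmem : ∫⁻ ω, tiltWeight d a χ E φ ω ∂P ≤ 1 :=
    hseq.lintegral_tiltWeight_le_of_forall_gt hE fun lam hlam => by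
      rw [hseq.lintegral_tiltWeight hα hE (by linarith [neg_le_of_dormantMass_le_exp hbound])]
      exact (tiltedMeasure_univ_lt_one hα hρ₀pos hbound hlam).le
  have hpos' : ∀ lam, ∫⁻ ω, tiltWeight d a χ E lam ω ∂P ≤ 1 → 0 < α + lam := fun lam hlam => by
    by_contra hneg
    rw [hseq.lintegral_tiltWeight_eq_top hα hE hEtop (not_lt.1 hneg)] at hlam
    simp at hlam
  refine ⟨⟨hmem, fun lam hlam => ?_⟩, fun hG => ?_⟩
  · have hl := hpos' lam hlam
    rw [Set.mem_ofPred_eq, hseq.lintegral_tiltWeight hα hE hl] at hlam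
    -- Minimality: `φ` is the supremum of the rates, and each rate is at most `lam`.
    exact_mod_cast hψle lam fun t _ => dormantMass_le_exp hα hρ₀pos hl hlam t
  · have hl := hpos' φ hmem
    have hmem' := hmem
    rw [hseq.lintegral_tiltWeight hα hE hl] at hmem'
    -- Failure of `(G')` leaves a strict defect or an infinite mean; either way the tail is not
    -- integrable.
    have htail : ∫⁻ y, activeTail (tiltedMeasure α ρ₀ φ) y = ∞ := by
      rcases hmem'.lt_or_eq with hlt | heq
      · exact lintegral_activeTail_of_lt hlt
      · by_contra hfin
        rw [lintegral_activeTail (ae_pos_tiltedMeasure hρ₀pos) heq] at hfin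
        exact hG ⟨φ, by rw [hseq.lintegral_tiltWeight hα hE hl, heq],
          hseq.lintegral_firstCycle_mul_tiltWeight_lt_top hα hE hl (by rw [heq]; simp) hfin⟩
    have h0 := ENNReal.Tendsto.const_mul (a := c⁻¹)
      (tendsto_dormantMass_mul_exp hα hρ₀pos hl hmem' htail) (Or.inr (ENNReal.inv_ne_top.2 hc0))
    rw [mul_zero] at h0
    refine tendsto_of_tendsto_of_tendsto_of_le_of_le' tendsto_const_nhds h0
      (Eventually.of_forall fun t => zero_le) ?_
    filter_upwards [eventually_gt_atTop 0] with t ht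
    calc _ ≤ c⁻¹ * dormantMass α ρ₀ t * ENNReal.ofReal (Real.exp (-φ * t)) := by
          gcongr; exact hZg t ht
      _ = _ := by rw [neg_mul]; ring
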